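/- All spaces are complex and separable. A Pontryagin space is a space $\mathcal H$ with an indefinite inner product $\langle\cdot,\cdot\rangle$ that has a fundamental decomposition, i.e. an orthogonal direct sum $\mathcal H=\mathcal H_+\oplus\mathcal H_-$ in which $(\mathcal H_+,\langle\cdot,\cdot\rangle)$ is a Hilbert space, $\mathcal H_-$ is negative definite and finite-dimensional; $\operatorname{ind}_-\mathcal H=\dim\mathcal H_-$ is its negative index. Topological notions refer to the Hilbert norm of a fundamental decomposition; adjoints ${}^*$, orthogonal complements ${}^\perp$ and contractivity refer to the indefinite inner products. A closed subspace is regular if it is itself a Pontryagin space in the inherited inner product, and a regular subspace of negative index $0$ is called a Hilbert subspace. Let $\mathcal X,\mathcal U,\mathcal Y$ be separable Pontryagin spaces with $\operatorname{ind}_-\mathcal U=\operatorname{ind}_-\mathcal Y$ and $\operatorname{ind}_-\mathcal X=\kappa\in\{0,1,2,\dots\}$. Let $\theta$ belong to the generalized Schur class $\mathbf S_\kappa(\mathcal U,\mathcal Y)$: $\theta$ is an $\mathcal L(\mathcal U,\mathcal Y)$-valued function, holomorphic in a connected open neighbourhood $\Omega\subset\mathbb D$ of the origin, and its Schur kernel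 $$K_\theta(w,z)=\frac{1-\theta(z)\theta(w)^*}{1-z\bar w},\qquad w,z\in\Omega,$$ has $\kappa$ negative squares, i.e. each Hermitian matrix $\big(\langle K_\theta(w_j,w_i)f_j,f_i\rangle_{\mathcal Y}\big)_{i,j=1}^n$ with $w_1,\dots,w_n\in\Omega$ and $f_1,\dots,f_n\in\mathcal Y$ has at most $\kappa$ negative eigenvalues, counted with multiplicity, and at least one such matrix has exactly $\kappa$. Let $\Sigma=(A,B,C,D;\mathcal X,\mathcal U,\mathcal Y;\kappa)$ be a passive realization of $\theta$: $A\in\mathcal L(\mathcal X)$, $B\in\mathcal L(\mathcal U,\mathcal X)$, $C\in\mathcal L(\mathcal X,\mathcal Y)$, $D\in\mathcal L(\mathcal U,\mathcal Y)$ are bounded operators such that $\begin{pmatrix}A&B\\C&D\end{pmatrix}:\mathcal X\oplus\mathcal U\to\mathcal X\oplus\mathcal Y$ is a contraction, and $\theta(z)=D+zC(I-zA)^{-1}B$ for all $z$ in a neighbourhood of the origin. Put $$\mathcal X^c=\overline{\operatorname{span}}\{\operatorname{ran}A^nB: n\ge0\},\qquad \mathcal X^o=\overline{\operatorname{span}}\{\operatorname{ran}A^{*n}C^*: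 n\ge0\},\qquad \mathcal X^s=\overline{\operatorname{span}}\{\operatorname{ran}A^nB,\ \operatorname{ran}A^{*m}C^*: n,m\ge0\}.$$ Then the subspaces $\mathcal X^c$, $\mathcal X^o$ and $\mathcal X^s$ of $\mathcal X$ are regular, and their orthogonal complements $(\mathcal X^c)^\perp$, $(\mathcal X^o)^\perp$ and $(\mathcal X^s)^\perp$ are Hilbert subspaces of $\mathcal X$. -/

import Mathlib

open scoped ComplexConjugate Topology

noncomputable section

/-- A Pontryagin space, presented by a fundamental symmetry `J` on a complex Hilbert space: the
indefinite inner product is `[x, y] = ⟨J x, y⟩`, the eigenspaces of `J` for `1` and `-1` are the two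
parts of a fundamental decomposition, and the Hilbert norm is the norm of that decomposition, so that
the norm topology is the strong topology.  The negative part has finite dimension. -/
class PontryaginSpace (X : Type*) [NormedAddCommGroup X] [InnerProductSpace ℂ X]
    [CompleteSpace X] where
  J : X →L[ℂ] X
  J_symm : ∀ x y : X, inner ℂ (J x) y = inner ℂ x (J y)
  J_invol : ∀ x : X, J (J x) = x
  J_finite : FiniteDimensional ℂ (LinearMap.ker (J + ContinuousLinearMap.id ℂ X).toLinearMap)

namespace PontryaginSpace

section Space

variable {X : Type*} [NormedAddCommGroup X] [InnerProductSpace ℂ X] [CompleteSpace X]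
  [PontryaginSpace X]

/-- The indefinite inner product `[x, y]`, linear in `x` and conjugate linear in `y`. -/
def form (x y : X) : ℂ := inner ℂ y (J x)

theorem form_conj (x y : X) : conj (form x y) = form y x := by
  unfold form
  rw [inner_conj_symm, J_symm]

variable (X) in
/-- The negative index of a Pontryagin space. -/
def negIndex : ℕ :=
  Module.finrank ℂ (LinearMap.ker (J + ContinuousLinearMap.id ℂ X : X →L[ℂ] X).toLinearMap)

/-- The orthogonal complement with respect to the indefinite inner product. -/
def orthCompl (N : Submodule ℂ X) : Submodule ℂ X where
  carrier := {x | ∀ y ∈ N, form x y = 0}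
  add_mem' := by
    intro a b ha hb y hy
    have h1 := ha y hy
    have h2 := hb y hy
    simp only [form, map_add, inner_add_right] at *
    rw [h1, h2, add_zero]
  zero_mem' := by
    intro y _
    simp [form]
  smul_mem' := by
    intro c a ha y hy
    have h1 := ha y hy
    simp only [form, map_smul, inner_smul_right] at *
    rw [h1, mul_zero]

/-- `N = P ⊕ M` is a fundamental decomposition of the subspace `N`, with the inner product inherited
from the whole space: `P` and `M` are orthogonal, `P` is a Hilbert space in the inherited inner
product, and `M` is finite-dimensional and negative definite. -/
structure IsFundamentalDecomposition (N P M : Submodule ℂ X) : Prop where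
  sup_eq : P ⊔ M = N
  orth : ∀ x ∈ P, ∀ y ∈ M, form x y = 0
  pos : ∀ x ∈ P, x ≠ 0 → 0 < (form x x).re
  complete : ∀ u : ℕ → X, (∀ n, u n ∈ P) →
    (∀ ε : ℝ, 0 < ε → ∃ n₀ : ℕ, ∀ m ≥ n₀, ∀ n ≥ n₀, (form (u m - u n) (u m - u n)).re < ε) →
    ∃ x ∈ P, Filter.Tendsto (fun n => (form (u n - x) (u n - x)).re) Filter.atTop (𝓝 0)
  finite : FiniteDimensional ℂ M
  neg : ∀ x ∈ M, x ≠ 0 → (form x x).re < 0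

/-- The subspace `N` is regular: it is closed, and it is itself a Pontryagin space in the inherited
inner product. -/
def IsRegular (N : Submodule ℂ X) : Prop :=
  IsClosed (N : Set X) ∧ ∃ P M : Submodule ℂ X, IsFundamentalDecomposition N P M

/-- The subspace `N` has negative index `k` in the inherited inner product. -/
def HasNegIndex (N : Submodule ℂ X) (k : ℕ) : Prop :=
  ∃ P M : Submodule ℂ X, IsFundamentalDecomposition N P M ∧ Module.finrank ℂ M = k

/-- A Hilbert subspace: a regular subspace with negative index zero. -/
def IsHilbertSubspace (N : Submodule ℂ X) : Prop :=
  IsRegular N ∧ HasNegIndex N 0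

/-- The eigenspaces of `J` form a fundamental decomposition of the whole space. -/
theorem hasNegIndex_top : HasNegIndex (⊤ : Submodule ℂ X) (negIndex X) := by
  refine ⟨LinearMap.ker (J - ContinuousLinearMap.id ℂ X : X →L[ℂ] X).toLinearMap,
    LinearMap.ker (J + ContinuousLinearMap.id ℂ X : X →L[ℂ] X).toLinearMap, ?_, rfl⟩
  have hP : ∀ x : X, x ∈ LinearMap.ker (J - ContinuousLinearMap.id ℂ X : X →L[ℂ] X).toLinearMap
      ↔ J x = x := by
    intro x
    simp [LinearMap.mem_ker, sub_eq_zero]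
  have hM : ∀ x : X, x ∈ LinearMap.ker (J + ContinuousLinearMap.id ℂ X : X →L[ℂ] X).toLinearMap
      ↔ J x = -x := by
    intro x
    simp [LinearMap.mem_ker, add_eq_zero_iff_eq_neg]
  have hform : ∀ x : X, J x = x → (form x x).re = ‖x‖ ^ 2 := by
    intro x hx
    rw [form, hx, inner_self_eq_norm_sq_to_K]
    norm_cast
  refine ⟨?_, ?_, ?_, ?_, J_finite, ?_⟩
  · rw [eq_top_iff]
    intro x _
    refine Submodule.mem_sup.2 ⟨(2 : ℂ)⁻¹ • (x + J x), (hP _).2 ?_,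
      (2 : ℂ)⁻¹ • (x - J x), (hM _).2 ?_, ?_⟩
    · rw [map_smul, map_add, J_invol, add_comm]
    · rw [map_smul, map_sub, J_invol, ← smul_neg, neg_sub]
    · module
  · intro x hx y hy
    have h1 : form x y = inner ℂ y x := by rw [form, (hP x).1 hx]
    have h2 : form x y = - inner ℂ y x := by
      rw [form, ← J_symm, (hM y).1 hy, inner_neg_left]
    have h3 := h1.symm.trans h2
    rw [h1]
    exact self_eq_neg.1 h3
  · intro x hx hx0
    rw [hform x ((hP x).1 hx)]
    have := norm_pos_iff.2 hx0
    positivity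
  · intro u hu hC
    have hJ : ∀ n, J (u n) = u n := fun n => (hP _).1 (hu n)
    have hcs : CauchySeq u := by
      rw [Metric.cauchySeq_iff]
      intro ε hε
      obtain ⟨n₀, h⟩ := hC (ε ^ 2) (by positivity)
      refine ⟨n₀, fun m hm n hn => ?_⟩
      have := h m hm n hn
      rw [hform _ (by rw [map_sub, hJ, hJ])] at this
      rw [dist_eq_norm]
      exact lt_of_pow_lt_pow_left₀ 2 hε.le this
    obtain ⟨x, hx⟩ := cauchySeq_tendsto_of_complete hcs
    have hJx : J x = x := by
      have h1 := ((J : X →L[ℂ] X).continuous.tendsto x).comp hx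
      have h2 : (J ∘ u) = u := funext hJ
      rw [h2] at h1
      exact tendsto_nhds_unique h1 hx
    refine ⟨x, (hP x).2 hJx, ?_⟩
    have h1 : Filter.Tendsto (fun n => ‖u n - x‖ ^ 2) Filter.atTop (𝓝 0) := by
      simpa using ((hx.sub_const x).norm.pow 2)
    refine h1.congr fun n => ?_
    rw [hform _ (by rw [map_sub, hJ, hJx])]
  · intro x hx hx0
    rw [form, (hM x).1 hx, inner_neg_right, inner_self_eq_norm_sq_to_K]
    have := norm_pos_iff.2 hx0
    have h : (0 : ℝ) < ‖x‖ ^ 2 := by positivity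
    rw [Complex.neg_re]
    have h2 : (((‖x‖ : ℝ) : ℂ) ^ 2).re = ‖x‖ ^ 2 := by norm_cast
    erw [h2]
    linarith

end Space

/-- The orthogonal direct sum `X ⊕ U` of two Pontryagin spaces. -/
instance instProd {X U : Type*} [NormedAddCommGroup X] [InnerProductSpace ℂ X] [CompleteSpace X]
    [PontryaginSpace X] [NormedAddCommGroup U] [InnerProductSpace ℂ U] [CompleteSpace U]
    [PontryaginSpace U] : PontryaginSpace (WithLp 2 (X × U)) where
  J := (WithLp.prodContinuousLinearEquiv 2 ℂ X U).symm.toContinuousLinearMap ∘L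
    ((J : X →L[ℂ] X).prodMap (J : U →L[ℂ] U)) ∘L
      (WithLp.prodContinuousLinearEquiv 2 ℂ X U).toContinuousLinearMap
  J_symm := by
    intro x y
    simp [WithLp.prod_inner_apply, J_symm]
  J_invol := by
    intro x
    apply (WithLp.prodContinuousLinearEquiv 2 ℂ X U).injective
    simp [J_invol, Prod.ext_iff]
  J_finite := by
    have hX : FiniteDimensional ℂ (LinearMap.ker (J + ContinuousLinearMap.id ℂ X).toLinearMap) :=
      J_finite
    have hU : FiniteDimensional ℂ (LinearMap.ker (J + ContinuousLinearMap.id ℂ U).toLinearMap) :=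
      J_finite
    have hfin := (Submodule.fg_iff_finiteDimensional _).2 hX |>.prod
      ((Submodule.fg_iff_finiteDimensional _).2 hU)
    have hmap := hfin.map (WithLp.linearEquiv 2 ℂ (X × U)).symm.toLinearMap
    refine (Submodule.fg_iff_finiteDimensional _).1 ?_
    refine (congrArg Submodule.FG ?_).mp hmap
    symm
    ext x
    constructor
    · intro hx
      refine ⟨x.ofLp, ?_, rfl⟩
      have h := congrArg WithLp.ofLp (LinearMap.mem_ker.1 hx)
      simpa [Submodule.mem_prod, Prod.ext_iff] using h
    · rintro ⟨y, hy, rfl⟩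
      have h : J y.1 + y.1 = 0 ∧ J y.2 + y.2 = 0 := by simpa [Submodule.mem_prod] using hy
      rw [LinearMap.mem_ker]
      apply (WithLp.linearEquiv 2 ℂ (X × U)).injective
      simpa [Prod.ext_iff] using h

section Operators

variable {X Y : Type*} [NormedAddCommGroup X] [InnerProductSpace ℂ X] [CompleteSpace X]
  [PontryaginSpace X] [NormedAddCommGroup Y] [InnerProductSpace ℂ Y] [CompleteSpace Y]
  [PontryaginSpace Y]

/-- The adjoint of an operator with respect to the indefinite inner products. -/
def indefAdjoint (T : X →L[ℂ] Y) : Y →L[ℂ] X :=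
  J ∘L ContinuousLinearMap.adjoint T ∘L J

theorem form_indefAdjoint (T : X →L[ℂ] Y) (x : X) (y : Y) :
    form (T x) y = form x (indefAdjoint T y) := by
  simp only [form, indefAdjoint, ContinuousLinearMap.comp_apply]
  rw [J_symm, J_invol, ContinuousLinearMap.adjoint_inner_left, J_symm]

/-- A contraction with respect to the indefinite inner products. -/
def IsContraction (T : X →L[ℂ] Y) : Prop :=
  ∀ x : X, (form (T x) (T x)).re ≤ (form x x).re

end Operators

section GeneralizedSchur

variable {U Y : Type*} [NormedAddCommGroup U] [InnerProductSpace ℂ U] [CompleteSpace U]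
  [PontryaginSpace U] [NormedAddCommGroup Y] [InnerProductSpace ℂ Y] [CompleteSpace Y]
  [PontryaginSpace Y]

/-- The Schur kernel `K_S(w, z) = (1 - S(z) S(w)^*) / (1 - z w̄)`. -/
def schurKernel (S : ℂ → U →L[ℂ] Y) (w z : ℂ) : Y →L[ℂ] Y :=
  (1 - z * conj w)⁻¹ • (ContinuousLinearMap.id ℂ Y - S z ∘L indefAdjoint (S w))

/-- The matrix `([K_S(w_j, w_i) f_j, f_i])_{i,j}`. -/
def schurMatrix (S : ℂ → U →L[ℂ] Y) {n : ℕ} (w : Fin n → ℂ) (f : Fin n → Y) :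
    Matrix (Fin n) (Fin n) ℂ :=
  Matrix.of fun i j => form (schurKernel S (w j) (w i) (f j)) (f i)

theorem schurMatrix_isHermitian (S : ℂ → U →L[ℂ] Y) {n : ℕ} (w : Fin n → ℂ) (f : Fin n → Y) :
    (schurMatrix S w f).IsHermitian := by
  have key : ∀ i j, schurMatrix S w f i j = (1 - w i * conj (w j))⁻¹ *
      (form (f j) (f i) - form (indefAdjoint (S (w j)) (f j)) (indefAdjoint (S (w i)) (f i))) := by
    intro i j
    rw [← form_indefAdjoint]
    simp only [schurMatrix, schurKernel, Matrix.of_apply, form, _root_.smul_apply,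
      _root_.sub_apply, ContinuousLinearMap.comp_apply, ContinuousLinearMap.id_apply,
      map_smul, map_sub, inner_smul_right, inner_sub_right]
  ext i j
  rw [Matrix.conjTranspose_apply, key, key]
  simp only [← starRingEnd_apply, map_mul, map_inv₀, map_sub, map_one, form_conj, Complex.conj_conj]
  rw [mul_comm (conj (w j))]

/-- The number of negative eigenvalues of a Hermitian matrix, with multiplicity. -/
def negEigenvalueCount {n : ℕ} {M : Matrix (Fin n) (Fin n) ℂ} (hM : M.IsHermitian) : ℕ :=
  (Finset.univ.filter fun i => hM.eigenvalues i < 0).card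

/-- The Schur kernel of `S` has `κ` negative squares on `Ω`. -/
def HasNegSquares (S : ℂ → U →L[ℂ] Y) (Ω : Set ℂ) (κ : ℕ) : Prop :=
  (∀ (n : ℕ) (w : Fin n → ℂ) (f : Fin n → Y), (∀ i, w i ∈ Ω) →
    negEigenvalueCount (schurMatrix_isHermitian S w f) ≤ κ) ∧
  ∃ (n : ℕ) (w : Fin n → ℂ) (f : Fin n → Y), (∀ i, w i ∈ Ω) ∧
    negEigenvalueCount (schurMatrix_isHermitian S w f) = κ

variable (U Y) in
/-- The generalized Schur class `S_κ(U, Y)`: functions holomorphic on some connected open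
neighbourhood `Ω` of the origin in the unit disk, whose Schur kernel has `κ` negative squares there.
(The values of `S` outside `Ω` are irrelevant.) -/
def generalizedSchurClass (κ : ℕ) : Set (ℂ → U →L[ℂ] Y) :=
  {S | ∃ Ω : Set ℂ, IsOpen Ω ∧ IsConnected Ω ∧ (0 : ℂ) ∈ Ω ∧ Ω ⊆ Metric.ball 0 1 ∧
    DifferentiableOn ℂ S Ω ∧ HasNegSquares S Ω κ}

end GeneralizedSchur

/-- A linear discrete-time system (operator colligation) with state space `X`, incoming space `U`
and outgoing space `Y`. -/
structure LinearSystem (X U Y : Type*)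
    [NormedAddCommGroup X] [InnerProductSpace ℂ X] [CompleteSpace X] [PontryaginSpace X]
    [NormedAddCommGroup U] [InnerProductSpace ℂ U] [CompleteSpace U] [PontryaginSpace U]
    [NormedAddCommGroup Y] [InnerProductSpace ℂ Y] [CompleteSpace Y] [PontryaginSpace Y] where
  A : X →L[ℂ] X
  B : U →L[ℂ] X
  C : X →L[ℂ] Y
  D : U →L[ℂ] Y

namespace LinearSystem

variable {X U Y : Type*}
  [NormedAddCommGroup X] [InnerProductSpace ℂ X] [CompleteSpace X] [PontryaginSpace X]
  [NormedAddCommGroup U] [InnerProductSpace ℂ U] [CompleteSpace U] [PontryaginSpace U]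
  [NormedAddCommGroup Y] [InnerProductSpace ℂ Y] [CompleteSpace Y] [PontryaginSpace Y]

/-- The system operator `(x, u) ↦ (A x + B u, C x + D u)` from `X ⊕ U` to `X ⊕ Y`. -/
def systemOperator (S : LinearSystem X U Y) : WithLp 2 (X × U) →L[ℂ] WithLp 2 (X × Y) :=
  (WithLp.prodContinuousLinearEquiv 2 ℂ X Y).symm.toContinuousLinearMap ∘L
    ((S.A.coprod S.B).prod (S.C.coprod S.D)) ∘L
      (WithLp.prodContinuousLinearEquiv 2 ℂ X U).toContinuousLinearMap

/-- The system is passive: its system operator is a contraction. -/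
def IsPassive (S : LinearSystem X U Y) : Prop :=
  IsContraction S.systemOperator

/-- The transfer function `D + z C (I - z A)⁻¹ B`, meaningful where `I - z A` is invertible. -/
def transferFunction (S : LinearSystem X U Y) (z : ℂ) : U →L[ℂ] Y :=
  S.D + z • (S.C ∘L Ring.inverse (1 - z • S.A) ∘L S.B)

/-- The system is a realization of `θ`: its transfer function coincides with `θ` in a neighbourhood
of the origin (where `I - z A` is invertible). -/
def IsRealization (S : LinearSystem X U Y) (θ : ℂ → U →L[ℂ] Y) : Prop :=
  ∀ᶠ z in 𝓝 (0 : ℂ), IsUnit (1 - z • S.A) ∧ S.transferFunction z = θ z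

/-- The controllable subspace: the closed linear span of the ranges of `A ^ n B`. -/
def controllableSubspace (S : LinearSystem X U Y) : Submodule ℂ X :=
  (⨆ n : ℕ, LinearMap.range ((S.A ^ n) ∘L S.B).toLinearMap).topologicalClosure

/-- The observable subspace: the closed linear span of the ranges of `(A^*) ^ n C^*`. -/
def observableSubspace (S : LinearSystem X U Y) : Submodule ℂ X :=
  (⨆ n : ℕ, LinearMap.range (indefAdjoint (S.A ^ n) ∘L indefAdjoint S.C).toLinearMap).topologicalClosure

/-- The simple subspace: the closed linear span of the ranges of `A ^ n B` and `(A^*) ^ m C^*`. -/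
def simpleSubspace (S : LinearSystem X U Y) : Submodule ℂ X :=
  ((⨆ n : ℕ, LinearMap.range ((S.A ^ n) ∘L S.B).toLinearMap) ⊔
    (⨆ m : ℕ, LinearMap.range
      ((indefAdjoint S.A ^ m) ∘L indefAdjoint S.C).toLinearMap)).topologicalClosure

end LinearSystem

end PontryaginSpace

end

/-! Everything reduces to finding a `κ`-dimensional negative definite subspace inside each of the
three subspaces. Since `κ` is the negative index of the state space, such a subspace is maximal: its
orthogonal complement is positive definite. A closed subspace containing it then splits as itself
plus a positive part, and a closed positive definite subspace of a Pontryagin space is uniformly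
positive, hence complete (`exists_mul_norm_sq_le`). This gives both regularity and the Hilbert
complements.

Negative states come from energy balance. Starting from state zero, passivity bounds the form of the
state at time `n` by input energy minus output energy, so a negative direction of the truncated
defect `1 - T*T` produces a negative controllable state. The dual system is also passive, so a
negative direction of `1 - TT*` produces a negative observable state. The two defects are tied
together by an inertia count, `NegDim.adjoint_defect`, which uses that the negative indices of `U`
and `Y` agree; the same count proves passivity of the dual.

The defect `1 - TT*` sees the Schur kernel through geometric sequences with terms `conj w ^ k • f`:
its Gram kernel on them tends to that of the Schur kernel as `n → ∞` (`tendsto_defectKernel`).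
Negative definiteness of a finite matrix is an open condition, so some finite `n` suffices.

The limit is available only for `w` near the origin, while the negative squares are given on all of
`Ω`. To localize them (`HasNegSquares.exists_neg_near`), the sign of the Schur kernel is changed on
a maximal negative subspace. The resulting positive kernel lives in a Hilbert space, where the
identity theorem on the connected set `Ω` shows that kernel vectors at points near `0` are total.
The negative vectors can thus be approximated by combinations supported near `0`. -/

noncomputable section

open scoped ComplexConjugate Topology

universe u

namespace PontryaginSpace

/-! ### Inertia of quadratic forms on vector spaces without topology. -/

section NegativeDimension

variable {E F : Type*} [AddCommGroup E] [Module ℂ E] [AddCommGroup F] [Module ℂ F]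

/-- The function `q` is negative on the nonzero vectors of some `k`-dimensional subspace. -/
def NegDim (q : E → ℝ) (k : ℕ) : Prop :=
  ∃ φ : (Fin k → ℂ) →ₗ[ℂ] E, ∀ c, c ≠ 0 → q (φ c) < 0

/-- The function `q` is nonnegative on some subspace of codimension at most `p`. -/
def NonnegCodim (q : E → ℝ) (p : ℕ) : Prop :=
  ∃ π : E →ₗ[ℂ] (Fin p → ℂ), ∀ x, π x = 0 → 0 ≤ q x

theorem exists_injective_of_finrank_le {V W : Type*} [AddCommGroup V] [Module ℂ V]
    [FiniteDimensional ℂ V] [AddCommGroup W] [Module ℂ W] [FiniteDimensional ℂ W]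
    (h : Module.finrank ℂ V ≤ Module.finrank ℂ W) :
    ∃ f : V →ₗ[ℂ] W, Function.Injective f := by
  let b := Module.finBasis ℂ V
  let d := Module.finBasis ℂ W
  refine ⟨b.constr ℂ fun i => d (Fin.castLE h i), ?_⟩
  exact b.injective_constr_of_linearIndependent
    (d.linearIndependent.comp _ (Fin.castLE_injective h))

theorem negDim_of_finrank {V : Type*} [AddCommGroup V] [Module ℂ V] [FiniteDimensional ℂ V]
    {q : E → ℝ} {k : ℕ} (hk : k ≤ Module.finrank ℂ V) (φ : V →ₗ[ℂ] E)
    (h : ∀ v, v ≠ 0 → q (φ v) < 0) : NegDim q k := by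
  obtain ⟨f, hf⟩ := exists_injective_of_finrank_le (V := Fin k → ℂ) (W := V) (by simpa using hk)
  exact ⟨φ ∘ₗ f, fun c hc => h _ ((map_ne_zero_iff f hf).2 hc)⟩

theorem nonnegCodim_of_finrank {V : Type*} [AddCommGroup V] [Module ℂ V] [FiniteDimensional ℂ V]
    {q : E → ℝ} {p : ℕ} (hp : Module.finrank ℂ V ≤ p) (π : E →ₗ[ℂ] V)
    (h : ∀ x, π x = 0 → 0 ≤ q x) : NonnegCodim q p := by
  obtain ⟨f, hf⟩ := exists_injective_of_finrank_le (V := V) (W := Fin p → ℂ) (by simpa using hp)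
  exact ⟨f ∘ₗ π, fun x hx => h x ((map_eq_zero_iff f hf).1 hx)⟩

theorem NegDim.map {q : E → ℝ} {q' : F → ℝ} {k : ℕ} (h : NegDim q k) (ψ : E →ₗ[ℂ] F)
    (hψ : ∀ x, q' (ψ x) ≤ q x) : NegDim q' k := by
  obtain ⟨φ, hφ⟩ := h
  exact ⟨ψ ∘ₗ φ, fun c hc => (hψ _).trans_lt (hφ c hc)⟩

theorem NegDim.le {q : E → ℝ} {k p : ℕ} (h : NegDim q k) (h' : NonnegCodim q p) : k ≤ p := by
  obtain ⟨φ, hφ⟩ := h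
  obtain ⟨π, hπ⟩ := h'
  have hinj : Function.Injective (π ∘ₗ φ) := by
    rw [← LinearMap.ker_eq_bot, LinearMap.ker_eq_bot']
    intro c hc
    by_contra h0
    exact (hφ c h0).not_ge (hπ _ hc)
  simpa using LinearMap.finrank_le_finrank_of_injective hinj

theorem not_negDim_one {q : E → ℝ} (h : ∀ x, 0 ≤ q x) : ¬ NegDim q 1 := by
  rintro ⟨φ, hφ⟩
  exact (hφ 1 one_ne_zero).not_ge (h _)

/-- Nonnegativity of a form is the case of negative dimension zero. This lets contractivity of an
adjoint be deduced from `NegDim.adjoint_defect` with `m = 1`. -/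
theorem nonneg_of_not_negDim_one {q : E → ℝ} (hq : ∀ (c : ℂ) x, q (c • x) = ‖c‖ ^ 2 * q x)
    (h : ¬ NegDim q 1) (x : E) : 0 ≤ q x := by
  by_contra hx
  refine h (negDim_of_finrank (V := ℂ) (by simp) (LinearMap.toSpanSingleton ℂ E x) ?_)
  intro c hc
  rw [LinearMap.toSpanSingleton_apply, hq]
  have := norm_pos_iff.2 hc
  exact mul_neg_of_pos_of_neg (by positivity) (not_le.1 hx)

/-- If `T` and `T'` are adjoint to each other, the negative dimension of the defect `1 - T T'` is
attained by the defect `1 - T' T`, provided that the negative index of the domain is not smaller than that of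
the codomain. -/
theorem NegDim.adjoint_defect {qE : E → ℝ} {qF : F → ℝ} {bE : E → E → ℝ} {bF : F → F → ℝ}
    (hE : ∀ x t, qE (x + t) = qE x + 2 * bE x t + qE t)
    (hF : ∀ y s, qF (y + s) = qF y + 2 * bF y s + qF s) (hE0 : qE 0 = 0) (hF0 : qF 0 = 0)
    (T : E →ₗ[ℂ] F) (T' : F →ₗ[ℂ] E) (hT : ∀ x y, bF (T x) y = bE x (T' y))
    {p m : ℕ} (hp : NegDim qE p) (hp' : NonnegCodim qF p)
    (h : NegDim (fun y => qF y - qE (T' y)) m) : NegDim (fun x => qE x - qF (T x)) m := by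
  obtain ⟨φ, hφ⟩ := hp
  obtain ⟨ψ, hψ⟩ := h
  obtain ⟨π, hπ⟩ := hp'
  -- With `ξ = φ a - T' ψ b`, completing squares gives `qE ξ - qF (T ξ) = qE (φ a) + (qF (ψ b) - qE
  -- (T' ψ b)) - qF (T ξ + ψ b)`. The first two terms are negative unless `a`, respectively `b`,
  -- vanishes; the last is controlled by asking `L = T ξ + ψ b` to lie in the nonnegative subspace
  -- of `F`.
  let ξ : ((Fin p → ℂ) × (Fin m → ℂ)) →ₗ[ℂ] E :=
    (φ ∘ₗ LinearMap.fst ℂ _ _) - (T' ∘ₗ ψ ∘ₗ LinearMap.snd ℂ _ _)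
  let L : ((Fin p → ℂ) × (Fin m → ℂ)) →ₗ[ℂ] F := T ∘ₗ ξ + ψ ∘ₗ LinearMap.snd ℂ _ _
  -- That request costs at most `p` of the `p + m` dimensions, so at least `m` remain.
  have hdim : m ≤ Module.finrank ℂ (LinearMap.ker (π ∘ₗ L)) := by
    have h1 := LinearMap.finrank_range_add_finrank_ker (π ∘ₗ L)
    have h2 := Submodule.finrank_le (LinearMap.range (π ∘ₗ L))
    simp only [Module.finrank_prod, Module.finrank_fin_fun] at h1 h2
    omega
  refine negDim_of_finrank hdim (ξ ∘ₗ (LinearMap.ker (π ∘ₗ L)).subtype) ?_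
  rintro ⟨⟨a, b⟩, hv⟩ hv0
  have hab : a ≠ 0 ∨ b ≠ 0 := by
    by_contra! hcon
    exact hv0 (by ext1; exact Prod.ext hcon.1 hcon.2)
  have h1 : 0 ≤ qF (T (ξ (a, b)) + ψ b) := hπ _ hv
  have h2 : ξ (a, b) + T' (ψ b) = φ a := by simp [ξ]
  have h3 := hE (ξ (a, b)) (T' (ψ b))
  rw [h2] at h3
  rw [hF, hT] at h1
  change qE (ξ (a, b)) - qF (T (ξ (a, b))) < 0
  have ha : qE (φ a) ≤ 0 := by
    by_cases h0 : a = 0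
    · simp [h0, hE0]
    · exact (hφ a h0).le
  have hb : qF (ψ b) - qE (T' (ψ b)) ≤ 0 := by
    by_cases h0 : b = 0
    · simp [h0, hE0, hF0]
    · exact (hψ b h0).le
  rcases hab with h0 | h0
  · linarith [hφ a h0]
  · linarith [hψ b h0]

end NegativeDimension


/-! ### The negative index as inertia, for single spaces, products and finite time horizons. -/

section Index

variable {X : Type*} [NormedAddCommGroup X] [InnerProductSpace ℂ X] [CompleteSpace X]
  [PontryaginSpace X]

theorem form_add_left (x y z : X) : form (x + y) z = form x z + form y z := by
  simp [form]

theorem form_add_right (x y z : X) : form x (y + z) = form x y + form x z := by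
  simp [form]

theorem form_sub_left (x y z : X) : form (x - y) z = form x z - form y z := by
  simp [form]

theorem form_smul_left (c : ℂ) (x y : X) : form (c • x) y = c * form x y := by
  simp [form]

theorem form_smul_right (c : ℂ) (x y : X) : form x (c • y) = conj c * form x y := by
  simp [form, mul_comm]

theorem form_zero_left (y : X) : form (0 : X) y = 0 := by simp [form]

theorem form_zero_right (y : X) : form y (0 : X) = 0 := by simp [form]

theorem form_sum_right {ι : Type*} (s : Finset ι) (f : ι → X) (y : X) :
    form y (∑ i ∈ s, f i) = ∑ i ∈ s, form y (f i) := by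
  simp [form]

theorem continuous_form : Continuous fun p : X × X => form p.1 p.2 := by
  unfold form
  fun_prop

/-- The real quadratic form of the indefinite inner product. -/
def sqForm (x : X) : ℝ := (form x x).re

theorem sqForm_add (x y : X) : sqForm (x + y) = sqForm x + 2 * (form x y).re + sqForm y := by
  have h : (form y x).re = (form x y).re := by rw [← form_conj x y, Complex.conj_re]
  simp only [sqForm, form_add_left, form_add_right, Complex.add_re, h]
  ring

theorem sqForm_smul (c : ℂ) (x : X) : sqForm (c • x) = ‖c‖ ^ 2 * sqForm x := by
  rw [sqForm, form_smul_left, form_smul_right, ← mul_assoc, Complex.mul_conj, Complex.re_ofReal_mul,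
    Complex.normSq_eq_norm_sq, sqForm]

theorem sqForm_zero : sqForm (0 : X) = 0 := by simp [sqForm, form]

variable (X) in
/-- The negative part of the fundamental decomposition given by `J`. -/
def negPart : Submodule ℂ X :=
  LinearMap.ker (J + ContinuousLinearMap.id ℂ X : X →L[ℂ] X).toLinearMap

theorem mem_negPart {x : X} : x ∈ negPart X ↔ J x = -x := by
  rw [negPart, LinearMap.mem_ker]
  exact add_eq_zero_iff_eq_neg

/-- The projection onto the negative part of the fundamental decomposition. -/
def negProj : X →ₗ[ℂ]
    negPart X :=
  LinearMap.codRestrict _ ((2 : ℂ)⁻¹ • (LinearMap.id - (J : X →L[ℂ] X).toLinearMap)) fun x => by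
    simp [mem_negPart, J_invol]

theorem coe_negProj (x : X) : (negProj x : X) = (2 : ℂ)⁻¹ • (x - J x) := rfl

theorem norm_J (x : X) : ‖J x‖ = ‖x‖ := by
  have h : ‖J x‖ ^ 2 = ‖x‖ ^ 2 := by
    rw [← inner_self_eq_norm_sq (𝕜 := ℂ), ← inner_self_eq_norm_sq (𝕜 := ℂ), J_symm, J_invol]
  exact (sq_eq_sq₀ (norm_nonneg _) (norm_nonneg _)).1 h

/-- Splitting `x` into its positive and negative parts, the form is the difference of the squared
norms and the Hilbert norm square is their sum. -/
theorem sqForm_eq (x : X) : sqForm x = ‖x‖ ^ 2 - 2 * ‖negProj x‖ ^ 2 := by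
  have h1 := norm_sub_sq (𝕜 := ℂ) x (J x)
  rw [norm_J] at h1
  rw [Submodule.coe_norm, coe_negProj, norm_smul, mul_pow, h1]
  simp only [sqForm, form, norm_inv, Complex.norm_ofNat, RCLike.re_to_complex]
  ring

instance finiteDimensional_negPart : FiniteDimensional ℂ (negPart X) :=
  J_finite

theorem sqForm_of_mem_negPart
    (x : negPart X) :
    sqForm (x : X) = -‖x‖ ^ 2 := by
  have h : J (x : X) = -x := mem_negPart.1 x.2
  have h2 : negProj (x : X) = x := by
    ext
    rw [coe_negProj, h]
    module
  rw [sqForm_eq, h2, Submodule.coe_norm]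
  ring

theorem sqForm_pos_of_negProj {x : X} (h : negProj x = 0) (hx : x ≠ 0) : 0 < sqForm x := by
  rw [sqForm_eq, h, norm_zero]
  have := norm_pos_iff.2 hx
  nlinarith [sq_pos_of_pos this]

theorem sqForm_nonneg_of_negProj {x : X} (h : negProj x = 0) : 0 ≤ sqForm x := by
  rw [sqForm_eq, h, norm_zero]
  nlinarith [sq_nonneg ‖x‖]

variable {U : Type*} [NormedAddCommGroup U] [InnerProductSpace ℂ U] [CompleteSpace U]
  [PontryaginSpace U]

theorem negDim_sqForm_prod :
    NegDim (fun p : X × U => sqForm p.1 + sqForm p.2) (negIndex X + negIndex U) := by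
  refine negDim_of_finrank (V :=
    negPart X ×
    negPart U)
    (by rw [Module.finrank_prod]; rfl) ((Submodule.subtype _).prodMap (Submodule.subtype _)) ?_
  rintro ⟨x, u⟩ h
  simp only [LinearMap.prodMap_apply, Submodule.subtype_apply, sqForm_of_mem_negPart]
  have : x ≠ 0 ∨ u ≠ 0 := by
    by_contra! hcon
    exact h (Prod.ext hcon.1 hcon.2)
  rcases this with h0 | h0
  · have := norm_pos_iff.2 h0
    nlinarith [sq_pos_of_pos this, sq_nonneg ‖u‖]
  · have := norm_pos_iff.2 h0
    nlinarith [sq_pos_of_pos this, sq_nonneg ‖x‖]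

theorem nonnegCodim_sqForm_prod :
    NonnegCodim (fun p : X × U => sqForm p.1 + sqForm p.2) (negIndex X + negIndex U) := by
  refine nonnegCodim_of_finrank (V :=
    negPart X ×
    negPart U)
    (by rw [Module.finrank_prod]; rfl) (negProj.prodMap negProj) ?_
  rintro ⟨x, u⟩ h
  rw [LinearMap.prodMap_apply, Prod.mk_eq_zero] at h
  exact add_nonneg (sqForm_nonneg_of_negProj h.1) (sqForm_nonneg_of_negProj h.2)

/-- Together with `nonnegCodim_sqForm_seq`, this says that the energy on a horizon of length `n` has
inertia `n * negIndex U`. Sequences are infinite, but only their first `n` terms count; the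
witnesses vanish afterwards. -/
theorem negDim_sqForm_seq (n : ℕ) :
    NegDim (fun u : ℕ → U => ∑ k ∈ Finset.range n, sqForm (u k)) (n * negIndex U) := by
  refine negDim_of_finrank (V := Fin n →
    negPart U)
    (by rw [Module.finrank_pi_fintype, Finset.sum_const, Finset.card_univ, Fintype.card_fin]; rfl) (LinearMap.pi fun k => if h : k < n then
      Submodule.subtype _ ∘ₗ LinearMap.proj ⟨k, h⟩ else 0) ?_
  intro v hv
  obtain ⟨i, hi⟩ := Function.ne_iff.1 hv
  rw [Finset.sum_range]
  have h : ∀ j : Fin n, sqForm ((LinearMap.pi fun k => if h : k < n then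
      Submodule.subtype (negPart U)
        ∘ₗ LinearMap.proj (⟨k, h⟩ : Fin n) else 0) v j) = -‖v j‖ ^ 2 := by
    intro j
    rw [LinearMap.pi_apply, dif_pos j.2]
    exact sqForm_of_mem_negPart (v j)
  rw [Finset.sum_congr rfl fun j _ => h j]
  refine Finset.sum_neg' (fun j _ => ?_) ⟨i, Finset.mem_univ _, ?_⟩
  · exact neg_nonpos.2 (sq_nonneg _)
  · have := norm_pos_iff.2 hi
    have := sq_pos_of_pos this
    linarith

theorem nonnegCodim_sqForm_seq (n : ℕ) :
    NonnegCodim (fun u : ℕ → U => ∑ k ∈ Finset.range n, sqForm (u k)) (n * negIndex U) := by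
  refine nonnegCodim_of_finrank (V := Fin n →
    negPart U)
    (by rw [Module.finrank_pi_fintype, Finset.sum_const, Finset.card_univ, Fintype.card_fin]; rfl) (LinearMap.pi fun k : Fin n => negProj ∘ₗ LinearMap.proj (k : ℕ)) ?_
  intro u hu
  refine Finset.sum_nonneg fun k hk => sqForm_nonneg_of_negProj ?_
  exact congrFun hu ⟨k, Finset.mem_range.1 hk⟩

end Index

/-! ### Algebra and continuity of the indefinite adjoint. -/

section Adjoint

variable {X Y Z : Type*} [NormedAddCommGroup X] [InnerProductSpace ℂ X] [CompleteSpace X]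
  [PontryaginSpace X] [NormedAddCommGroup Y] [InnerProductSpace ℂ Y] [CompleteSpace Y]
  [PontryaginSpace Y] [NormedAddCommGroup Z] [InnerProductSpace ℂ Z] [CompleteSpace Z]
  [PontryaginSpace Z]

theorem indefAdjoint_comp (T : X →L[ℂ] Y) (R : Y →L[ℂ] Z) :
    indefAdjoint (R ∘L T) = indefAdjoint T ∘L indefAdjoint R := by
  ext z
  simp [indefAdjoint, J_invol]

theorem indefAdjoint_one : indefAdjoint (1 : X →L[ℂ] X) = 1 := by
  ext z
  have h : ContinuousLinearMap.adjoint (1 : X →L[ℂ] X) = 1 := star_one _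
  simp [indefAdjoint, h, J_invol]

theorem indefAdjoint_pow (T : X →L[ℂ] X) (n : ℕ) : indefAdjoint (T ^ n) = indefAdjoint T ^ n := by
  induction n with
  | zero => simp [indefAdjoint_one]
  | succ n ih =>
    rw [pow_succ, pow_succ', ← ih]
    exact indefAdjoint_comp _ _

theorem indefAdjoint_add (T R : X →L[ℂ] Y) :
    indefAdjoint (T + R) = indefAdjoint T + indefAdjoint R := by
  ext z
  simp [indefAdjoint]

theorem indefAdjoint_smul (c : ℂ) (T : X →L[ℂ] Y) :
    indefAdjoint (c • T) = conj c • indefAdjoint T := by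
  ext z
  simp only [indefAdjoint, map_smulₛₗ, ContinuousLinearMap.comp_apply, _root_.smul_apply]
  simp

theorem continuous_indefAdjoint :
    Continuous (indefAdjoint : (X →L[ℂ] Y) → (Y →L[ℂ] X)) := by
  unfold indefAdjoint
  fun_prop

end Adjoint

/-! ### Energy balance, duality and truncated input-output maps. -/

namespace LinearSystem

variable {X U Y : Type*}
  [NormedAddCommGroup X] [InnerProductSpace ℂ X] [CompleteSpace X] [PontryaginSpace X]
  [NormedAddCommGroup U] [InnerProductSpace ℂ U] [CompleteSpace U] [PontryaginSpace U]
  [NormedAddCommGroup Y] [InnerProductSpace ℂ Y] [CompleteSpace Y] [PontryaginSpace Y]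

theorem sqForm_prod (p : WithLp 2 (X × U)) : (form p p).re = sqForm p.fst + sqForm p.snd := by
  simp [form, sqForm, J, WithLp.prod_inner_apply]

/-- The energy balance of a passive system. -/
theorem IsPassive.sqForm_le {S : LinearSystem X U Y} (hS : S.IsPassive) (x : X) (u : U) :
    sqForm (S.A x + S.B u) + sqForm (S.C x + S.D u) ≤ sqForm x + sqForm u := by
  have h := hS (WithLp.toLp 2 (x, u))
  rw [sqForm_prod, sqForm_prod] at h
  simpa [systemOperator] using h

/-- The dual system. -/
def dual (S : LinearSystem X U Y) : LinearSystem X Y U where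
  A := indefAdjoint S.A
  B := indefAdjoint S.C
  C := indefAdjoint S.B
  D := indefAdjoint S.D

/-- The energy balance of the dual of a passive system. -/
theorem IsPassive.dual_sqForm_le {S : LinearSystem X U Y} (hS : S.IsPassive)
    (hUY : negIndex U = negIndex Y) (x : X) (y : Y) :
    sqForm (S.dual.A x + S.dual.B y) + sqForm (S.dual.C x + S.dual.D y) ≤ sqForm x + sqForm y := by
  let T : X × U →ₗ[ℂ] X × Y :=
    ((S.A.coprod S.B).prod (S.C.coprod S.D)).toLinearMap
  let T' : X × Y →ₗ[ℂ] X × U :=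
    ((S.dual.A.coprod S.dual.B).prod (S.dual.C.coprod S.dual.D)).toLinearMap
  have key : ¬ NegDim (fun p : X × Y => (sqForm p.1 + sqForm p.2)
      - (sqForm (T' p).1 + sqForm (T' p).2)) 1 := by
    intro h
    -- A negative direction for the defect of the adjoint would give one for the defect of the
    -- system operator. The domain and codomain have the same negative index because `U` and `Y` do.
    refine not_negDim_one (fun p : X × U => ?_) (NegDim.adjoint_defect
      (qE := fun p : X × U => sqForm p.1 + sqForm p.2)
      (qF := fun p : X × Y => sqForm p.1 + sqForm p.2)
      (bE := fun p r => (form p.1 r.1).re + (form p.2 r.2).re)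
      (bF := fun p r => (form p.1 r.1).re + (form p.2 r.2).re)
      ?_ ?_ (by simp [sqForm_zero]) (by simp [sqForm_zero]) T T' ?_
      negDim_sqForm_prod (hUY ▸ nonnegCodim_sqForm_prod) h)
    · have := hS.sqForm_le p.1 p.2
      simp only [sub_nonneg]
      exact this
    · intro p r
      simp only [Prod.fst_add, Prod.snd_add, sqForm_add]
      ring
    · intro p r
      simp only [Prod.fst_add, Prod.snd_add, sqForm_add]
      ring
    · intro p r
      simp only [T, T', dual, ContinuousLinearMap.coe_coe, ContinuousLinearMap.prod_apply,
        ContinuousLinearMap.coprod_apply, form_add_left, form_add_right, form_indefAdjoint,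
        Complex.add_re]
      ring
  have := nonneg_of_not_negDim_one (fun c p => ?_) key (x, y)
  · rw [sub_nonneg] at this
    exact this
  · simp only [map_smul, Prod.smul_fst, Prod.smul_snd, sqForm_smul]
    ring

/-- The state at time `n`, for the zero initial state, as a function of the input sequence. -/
def state (S : LinearSystem X U Y) : ℕ → (ℕ → U) →ₗ[ℂ] X
  | 0 => 0
  | n + 1 => S.A.toLinearMap ∘ₗ S.state n + S.B.toLinearMap ∘ₗ LinearMap.proj n

/-- The output sequence, for the zero initial state, as a function of the input sequence. -/
def output (S : LinearSystem X U Y) : (ℕ → U) →ₗ[ℂ] (ℕ → Y) :=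
  LinearMap.pi fun n => S.C.toLinearMap ∘ₗ S.state n + S.D.toLinearMap ∘ₗ LinearMap.proj n

theorem state_zero (S : LinearSystem X U Y) (u : ℕ → U) : S.state 0 u = 0 := rfl

theorem state_succ (S : LinearSystem X U Y) (n : ℕ) (u : ℕ → U) :
    S.state (n + 1) u = S.A (S.state n u) + S.B (u n) := rfl

theorem output_apply (S : LinearSystem X U Y) (u : ℕ → U) (n : ℕ) :
    S.output u n = S.C (S.state n u) + S.D (u n) := rfl

theorem state_mem (S : LinearSystem X U Y) (n : ℕ) (u : ℕ → U) :
    S.state n u ∈ ⨆ n : ℕ, LinearMap.range ((S.A ^ n) ∘L S.B).toLinearMap := by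
  have hA : ∀ x ∈ ⨆ n : ℕ, LinearMap.range ((S.A ^ n) ∘L S.B).toLinearMap,
      S.A x ∈ ⨆ n : ℕ, LinearMap.range ((S.A ^ n) ∘L S.B).toLinearMap := by
    intro x hx
    induction hx using Submodule.iSup_induction' with
    | mem i x hx =>
      obtain ⟨u, rfl⟩ := hx
      refine Submodule.mem_iSup_of_mem (i + 1) ⟨u, ?_⟩
      simp [pow_succ']
    | zero => simp
    | add x y _ _ hx hy => rw [map_add]; exact add_mem hx hy
  induction n with
  | zero => exact zero_mem _
  | succ n ih => exact add_mem (hA _ ih) (Submodule.mem_iSup_of_mem 0 ⟨u n, by simp⟩)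

/-- The energy balance telescopes, and the initial state is zero. -/
theorem sqForm_state_le {S : LinearSystem X U Y}
    (hS : ∀ x u, sqForm (S.A x + S.B u) + sqForm (S.C x + S.D u) ≤ sqForm x + sqForm u)
    (n : ℕ) (u : ℕ → U) :
    sqForm (S.state n u) ≤
      ∑ k ∈ Finset.range n, sqForm (u k) - ∑ k ∈ Finset.range n, sqForm (S.output u k) := by
  induction n with
  | zero => simp [state_zero, sqForm_zero]
  | succ n ih =>
    rw [Finset.sum_range_succ, Finset.sum_range_succ, state_succ, output_apply]
    linarith [hS (S.state n u) (u n)]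

/-- The reversal of the first `n` terms of a sequence. -/
def reverse (V : Type*) [AddCommGroup V] [Module ℂ V] (n : ℕ) : (ℕ → V) →ₗ[ℂ] (ℕ → V) :=
  LinearMap.funLeft ℂ V fun k => n - 1 - k

theorem reverse_apply {V : Type*} [AddCommGroup V] [Module ℂ V] (n k : ℕ) (v : ℕ → V) :
    reverse V n v k = v (n - 1 - k) := rfl

/-- The output operator of the dual system, run backwards on the time interval `[0, n)`. -/
def backOutput (S : LinearSystem X U Y) (n : ℕ) : (ℕ → Y) →ₗ[ℂ] (ℕ → U) :=
  reverse U n ∘ₗ S.dual.output ∘ₗ reverse Y n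

theorem backOutput_apply (S : LinearSystem X U Y) {n k : ℕ} (h : k < n) (y : ℕ → Y) :
    S.backOutput n y k = indefAdjoint S.B (S.dual.state (n - 1 - k) (reverse Y n y))
      + indefAdjoint S.D (y k) := by
  have h2 : n - 1 - (n - 1 - k) = k := by omega
  change S.dual.C _ + S.dual.D (y (n - 1 - (n - 1 - k))) = _
  rw [h2]
  rfl

theorem dual_state_reverse (S : LinearSystem X U Y) {n k : ℕ} (h : k < n) (y : ℕ → Y) :
    S.dual.state (n - k) (reverse Y n y) =
      indefAdjoint S.A (S.dual.state (n - 1 - k) (reverse Y n y)) + indefAdjoint S.C (y k) := by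
  have h1 : n - k = (n - 1 - k) + 1 := by omega
  have h2 : n - 1 - (n - 1 - k) = k := by omega
  rw [h1, state_succ, reverse_apply, h2]
  rfl

/-- The truncated backward dual map is the adjoint of the truncated input-output map. Pairing the
forward state at time `m` with the dual state at remaining time `n - m` gives a quantity whose
increments are the differences of the two summands; it vanishes at both ends, where one of the
states is zero. -/
theorem sum_form_output (S : LinearSystem X U Y) (n : ℕ) (u : ℕ → U) (y : ℕ → Y) :
    ∑ k ∈ Finset.range n, form (S.output u k) (y k) =
      ∑ k ∈ Finset.range n, form (u k) (S.backOutput n y k) := by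
  have key : ∀ m ≤ n, form (S.state m u) (S.dual.state (n - m) (reverse Y n y)) =
      ∑ k ∈ Finset.range m, form (u k) (S.backOutput n y k)
        - ∑ k ∈ Finset.range m, form (S.output u k) (y k) := by
    intro m
    induction m with
    | zero => simp [state_zero, form_zero_left]
    | succ m ih =>
      intro hm
      have h1 : n - (m + 1) = n - 1 - m := by omega
      have h2 := ih (by omega)
      rw [dual_state_reverse S (by omega)] at h2
      rw [Finset.sum_range_succ, Finset.sum_range_succ, state_succ, output_apply, h1,
        backOutput_apply S (by omega)]
      simp only [form_add_left, form_add_right, ← form_indefAdjoint] at h2 ⊢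
      linear_combination h2
  have h := key n le_rfl
  rw [Nat.sub_self, state_zero, form_zero_right] at h
  exact (sub_eq_zero.1 h.symm).symm

theorem sum_sqForm_reverse {V : Type*} [NormedAddCommGroup V] [InnerProductSpace ℂ V]
    [CompleteSpace V] [PontryaginSpace V] (n : ℕ) (v : ℕ → V) :
    ∑ k ∈ Finset.range n, sqForm (reverse V n v k) = ∑ k ∈ Finset.range n, sqForm (v k) :=
  Finset.sum_range_reflect (fun k => sqForm (v k)) n

/-- The defect of the truncated dual input-output map. -/
def dualDefect (S : LinearSystem X U Y) (n : ℕ) (y : ℕ → Y) : ℝ :=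
  ∑ k ∈ Finset.range n, sqForm (y k) - ∑ k ∈ Finset.range n, sqForm (S.backOutput n y k)

/-- This is the energy balance of the dual system; time reversal does not change the energies. -/
theorem IsPassive.negDim_dual_state {S : LinearSystem X U Y} (hS : S.IsPassive)
    (hUY : negIndex U = negIndex Y) {n κ : ℕ} (h : NegDim (S.dualDefect n) κ) :
    NegDim (fun y => sqForm (S.dual.state n y)) κ := by
  refine h.map (reverse Y n) fun y => ?_
  refine (sqForm_state_le (S := S.dual) (hS.dual_sqForm_le hUY) n (reverse Y n y)).trans_eq ?_
  rw [sum_sqForm_reverse, dualDefect, ← sum_sqForm_reverse n (S.dual.output (reverse Y n y))]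
  rfl

/-- The inertia count moves the negative directions from `1 - TT*` to `1 - T*T`, after which the
energy balance of the original system applies. -/
theorem IsPassive.negDim_state {S : LinearSystem X U Y} (hS : S.IsPassive)
    (hUY : negIndex U = negIndex Y) {n κ : ℕ} (h : NegDim (S.dualDefect n) κ) :
    NegDim (fun u => sqForm (S.state n u)) κ := by
  have h2 : NegDim (fun u => ∑ k ∈ Finset.range n, sqForm (u k)
      - ∑ k ∈ Finset.range n, sqForm (S.output u k)) κ := by
    refine NegDim.adjoint_defect
      (qE := fun u : ℕ → U => ∑ k ∈ Finset.range n, sqForm (u k))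
      (qF := fun y : ℕ → Y => ∑ k ∈ Finset.range n, sqForm (y k))
      (bE := fun u v => ∑ k ∈ Finset.range n, (form (u k) (v k)).re)
      (bF := fun u v => ∑ k ∈ Finset.range n, (form (u k) (v k)).re)
      ?_ ?_ (by simp [sqForm_zero]) (by simp [sqForm_zero]) S.output (S.backOutput n) ?_
      (negDim_sqForm_seq n) (hUY ▸ nonnegCodim_sqForm_seq n) h
    · intro x t
      simp only [Pi.add_apply, sqForm_add, Finset.sum_add_distrib, Finset.mul_sum]
    · intro x t
      simp only [Pi.add_apply, sqForm_add, Finset.sum_add_distrib, Finset.mul_sum]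
    · intro u y
      rw [← Complex.re_sum, ← Complex.re_sum, sum_form_output]
  exact h2.map LinearMap.id fun u => sqForm_state_le hS.sqForm_le n u

end LinearSystem

/-! ### Positive subspaces, and subspaces containing a maximal negative one. -/

section Geometry

variable {X : Type*} [NormedAddCommGroup X] [InnerProductSpace ℂ X] [CompleteSpace X]
  [PontryaginSpace X]

theorem continuous_sqForm : Continuous (sqForm : X → ℝ) :=
  Complex.continuous_re.comp (continuous_form.comp (continuous_id.prodMk continuous_id))

theorem mem_orthCompl {N : Submodule ℂ X} {x : X} : x ∈ orthCompl N ↔ ∀ y ∈ N, form x y = 0 :=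
  Iff.rfl

theorem isClosed_orthCompl (N : Submodule ℂ X) : IsClosed (orthCompl N : Set X) := by
  have h : (orthCompl N : Set X) = ⋂ y ∈ N, {x | form x y = 0} := by
    ext x
    simp [mem_orthCompl]
  rw [h]
  refine isClosed_biInter fun y _ => isClosed_eq ?_ continuous_const
  exact continuous_form.comp (continuous_id.prodMk continuous_const)

theorem orthCompl_anti {M N : Submodule ℂ X} (h : M ≤ N) : orthCompl N ≤ orthCompl M :=
  fun _ hx y hy => hx y (h hy)

/-- A closed positive definite subspace of a Pontryagin space is uniformly positive. -/
theorem exists_mul_norm_sq_le {P : Submodule ℂ X} (hP : IsClosed (P : Set X))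
    (hpos : ∀ x ∈ P, x ≠ 0 → 0 < sqForm x) :
    ∃ c : ℝ, 0 < c ∧ ∀ x ∈ P, c * ‖x‖ ^ 2 ≤ sqForm x := by
  -- On `L` the form is the Hilbert norm square. Its Hilbert complement `F` in `P` embeds into the
  -- finite-dimensional negative part, so compactness of the unit sphere gives a constant there. The
  -- two pieces are orthogonal for both inner products because `J` fixes `L`.
  let L : Submodule ℂ X := P ⊓ LinearMap.ker (negProj : X →ₗ[ℂ] negPart X)
  have hmem : ∀ x, x ∈ L ↔ x ∈ P ∧ J x = x := by
    intro x
    rw [Submodule.mem_inf, LinearMap.mem_ker, ← Subtype.coe_inj, coe_negProj]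
    refine and_congr_right fun _ => ?_
    rw [ZeroMemClass.coe_zero, smul_eq_zero, sub_eq_zero, eq_comm (a := x)]
    simp
  have hL : IsClosed (L : Set X) := by
    have : (L : Set X) = (P : Set X) ∩ {x | J x = x} := Set.ext hmem
    rw [this]
    exact hP.inter (isClosed_eq (J : X →L[ℂ] X).continuous continuous_id)
  have : CompleteSpace L := hL.completeSpace_coe
  let F : Submodule ℂ X := P ⊓ Lᗮ
  have : FiniteDimensional ℂ F := by
    refine FiniteDimensional.of_injective (negProj ∘ₗ F.subtype) ?_
    rw [← LinearMap.ker_eq_bot, LinearMap.ker_eq_bot']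
    rintro ⟨x, hxP, hxL⟩ hx
    have h : x ∈ L := ⟨hxP, hx⟩
    ext1
    exact inner_self_eq_zero.1 (hxL x h)
  obtain ⟨c, hc, hF⟩ : ∃ c : ℝ, 0 < c ∧ ∀ x : F, c * ‖x‖ ^ 2 ≤ sqForm (x : X) := by
    rcases subsingleton_or_nontrivial F with hs | hn
    · exact ⟨1, one_pos, fun x => by simp [Subsingleton.elim x 0, sqForm_zero]⟩
    have hcont : Continuous fun x : F => sqForm (x : X) :=
      continuous_sqForm.comp continuous_subtype_val
    obtain ⟨x₀, hx₀, hmin⟩ := (isCompact_sphere (0 : F) 1).exists_isMinOn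
      (NormedSpace.sphere_nonempty.2 zero_le_one) hcont.continuousOn
    have hx₀' : x₀ ≠ 0 := ne_zero_of_mem_unit_sphere ⟨x₀, hx₀⟩
    refine ⟨sqForm (x₀ : X), hpos _ x₀.2.1 (by simpa using hx₀'), fun x => ?_⟩
    by_cases hx : x = 0
    · simp [hx, sqForm_zero]
    have hn := norm_pos_iff.2 hx
    have h := hmin (a := ((‖x‖⁻¹ : ℝ) : ℂ) • x) (by
      rw [mem_sphere_zero_iff_norm, norm_smul, Complex.norm_real, norm_inv, norm_norm,
        inv_mul_cancel₀ hn.ne'])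
    simp only [Set.mem_ofPred_eq, Submodule.coe_smul, sqForm_smul, Complex.norm_real, norm_inv,
      norm_norm] at h
    rwa [inv_pow, inv_mul_eq_div, le_div_iff₀ (by positivity)] at h
  refine ⟨min 1 c, by positivity, fun x hx => ?_⟩
  let y : X := L.orthogonalProjectionOnto x
  have hy : y ∈ L := (L.orthogonalProjectionOnto x).2
  have hzL : x - y ∈ Lᗮ := L.sub_starProjection_mem_orthogonal x
  have hzF : x - y ∈ F := ⟨sub_mem hx hy.1, hzL⟩
  have hJy : J y = y := ((hmem y).1 hy).2
  have horth : form y (x - y) = 0 := by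
    rw [form, hJy]
    exact Submodule.inner_left_of_mem_orthogonal hy hzL
  have hyy : sqForm y = ‖y‖ ^ 2 := by
    rw [sqForm_eq, show negProj y = 0 from hy.2]
    simp
  have hadd : sqForm x = ‖y‖ ^ 2 + sqForm (x - y) := by
    conv_lhs => rw [← add_sub_cancel y x, sqForm_add, horth]
    simp [hyy]
  have hnorm : ‖x‖ ^ 2 = ‖y‖ ^ 2 + ‖x - y‖ ^ 2 := by
    conv_lhs => rw [← add_sub_cancel y x]
    rw [sq, sq, sq, norm_add_sq_eq_norm_sq_add_norm_sq_of_inner_eq_zero (𝕜 := ℂ)]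
    exact Submodule.inner_right_of_mem_orthogonal hy hzL
  have h1 := hF ⟨x - y, hzF⟩
  rw [Submodule.coe_norm] at h1
  rw [hadd, hnorm, mul_add]
  refine add_le_add ?_ (le_trans ?_ h1)
  · exact mul_le_of_le_one_left (by positivity) (min_le_left _ _)
  · exact mul_le_mul_of_nonneg_right (min_le_right _ _) (by positivity)

/-- Uniform positivity makes a Cauchy sequence for the form Cauchy in norm. -/
theorem exists_tendsto_sqForm {P : Submodule ℂ X} (hP : IsClosed (P : Set X))
    (hpos : ∀ x ∈ P, x ≠ 0 → 0 < sqForm x) (u : ℕ → X) (hu : ∀ n, u n ∈ P)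
    (hC : ∀ ε : ℝ, 0 < ε → ∃ n₀ : ℕ, ∀ m ≥ n₀, ∀ n ≥ n₀, sqForm (u m - u n) < ε) :
    ∃ x ∈ P, Filter.Tendsto (fun n => sqForm (u n - x)) Filter.atTop (𝓝 0) := by
  obtain ⟨c, hc, hle⟩ := exists_mul_norm_sq_le hP hpos
  have hcs : CauchySeq u := by
    rw [Metric.cauchySeq_iff]
    intro ε hε
    obtain ⟨n₀, h⟩ := hC (c * ε ^ 2) (by positivity)
    refine ⟨n₀, fun m hm n hn => ?_⟩
    have h1 := (hle _ (sub_mem (hu m) (hu n))).trans_lt (h m hm n hn)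
    rw [dist_eq_norm]
    exact lt_of_pow_lt_pow_left₀ 2 hε.le (lt_of_mul_lt_mul_left h1 hc.le)
  obtain ⟨x, hx⟩ := cauchySeq_tendsto_of_complete hcs
  refine ⟨x, hP.mem_of_tendsto hx (Filter.Eventually.of_forall hu), ?_⟩
  have h := (continuous_sqForm.tendsto _).comp (hx.sub_const x)
  rwa [sub_self, sqForm_zero] at h

section NegativeSubspace

variable {κ : ℕ} (hκ : negIndex X = κ) {L : (Fin κ → ℂ) →ₗ[ℂ] X}
  (hL : ∀ c, c ≠ 0 → sqForm (L c) < 0)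

-- A nonpositive vector orthogonal to the range of `L` would enlarge it to a nonpositive subspace of
-- dimension `κ + 1`. The negative projection is injective on that subspace, but its target has
-- dimension `κ`.
include hκ hL in
theorem sqForm_pos_of_mem_orthCompl {x : X} (hx : x ∈ orthCompl (LinearMap.range L))
    (hx0 : x ≠ 0) : 0 < sqForm x := by
  by_contra hneg
  rw [not_lt] at hneg
  have horth : ∀ c, form (L c) x = 0 := fun c => by
    rw [← form_conj, hx _ ⟨c, rfl⟩, map_zero]
  let T : (Fin κ → ℂ) × ℂ →ₗ[ℂ] X := L.coprod (LinearMap.toSpanSingleton ℂ X x)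
  have hT : ∀ c t, sqForm (T (c, t)) = sqForm (L c) + ‖t‖ ^ 2 * sqForm x := by
    intro c t
    simp only [T, LinearMap.coprod_apply, LinearMap.toSpanSingleton_apply]
    rw [sqForm_add, form_smul_right, horth, sqForm_smul]
    simp
  have hinj : Function.Injective (negProj ∘ₗ T) := by
    rw [← LinearMap.ker_eq_bot, LinearMap.ker_eq_bot']
    rintro ⟨c, t⟩ h
    have h0 : T (c, t) = 0 := by
      by_contra hne
      have h1 := sqForm_pos_of_negProj (x := T (c, t)) h hne
      rw [hT] at h1
      have h2 : sqForm (L c) ≤ 0 := by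
        by_cases hc : c = 0
        · simp [hc, sqForm_zero]
        · exact (hL c hc).le
      nlinarith [sq_nonneg ‖t‖]
    have hc : c = 0 := by
      by_contra hc
      have h1 : L c + t • x = 0 := h0
      have h2 : form (L c + t • x) (L c) = 0 := by rw [h1, form_zero_left]
      rw [form_add_left, form_smul_left, hx _ ⟨c, rfl⟩, mul_zero, add_zero] at h2
      have h3 := hL c hc
      rw [sqForm, h2] at h3
      simp at h3
    subst hc
    have h1 : L 0 + t • x = 0 := h0
    rw [map_zero, zero_add, smul_eq_zero] at h1
    simpa [hx0] using h1
  have hle := LinearMap.finrank_le_finrank_of_injective hinj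
  have hd : Module.finrank ℂ (negPart X) = κ := hκ
  rw [hd, Module.finrank_prod, Module.finrank_fin_fun, Module.finrank_self] at hle
  omega

-- The Gram map of a negative definite finite-dimensional subspace is injective, hence surjective,
-- so orthogonal projection onto the subspace exists.
include hL in
theorem exists_sub_mem_orthCompl (x : X) : ∃ c, x - L c ∈ orthCompl (LinearMap.range L) := by
  let G : (Fin κ → ℂ) →ₗ[ℂ] (Fin κ → ℂ) :=
    { toFun := fun c i => form (L c) (L (Pi.single i 1))
      map_add' := fun a b => by ext i; simp [form_add_left]
      map_smul' := fun r a => by ext i; simp [form_smul_left] }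
  have hexp : ∀ (y : X) (c : Fin κ → ℂ),
      form y (L c) = ∑ i, conj (c i) * form y (L (Pi.single i 1)) := by
    intro y c
    conv_lhs => rw [← Finset.univ_sum_single c]
    rw [map_sum, form_sum_right]
    refine Finset.sum_congr rfl fun i _ => ?_
    rw [← form_smul_right, ← map_smul, ← Pi.single_smul, smul_eq_mul, mul_one]
  have hinj : Function.Injective G := by
    rw [← LinearMap.ker_eq_bot, LinearMap.ker_eq_bot']
    intro c hc
    by_contra h0
    have h1 := hL c h0
    rw [sqForm, hexp, Finset.sum_eq_zero] at h1
    · simp at h1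
    · intro i _
      have : form (L c) (L (Pi.single i 1)) = 0 := congrFun hc i
      rw [this, mul_zero]
  obtain ⟨c, hc⟩ := LinearMap.surjective_of_injective hinj fun i => form x (L (Pi.single i 1))
  refine ⟨c, ?_⟩
  rintro _ ⟨d, rfl⟩
  rw [form_sub_left, hexp x, hexp (L c), sub_eq_zero]
  refine Finset.sum_congr rfl fun i _ => ?_
  have : form (L c) (L (Pi.single i 1)) = form x (L (Pi.single i 1)) := congrFun hc i
  rw [this]

include hκ hL in
/-- A closed subspace that contains a maximal negative definite subspace is regular. -/
theorem isRegular_of_range_le {N : Submodule ℂ X} (hN : IsClosed (N : Set X))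
    (hLN : LinearMap.range L ≤ N) : IsRegular N := by
  refine ⟨hN, N ⊓ orthCompl (LinearMap.range L), LinearMap.range L, ?_, ?_, ?_, ?_, ?_, ?_⟩
  · refine le_antisymm (sup_le inf_le_left hLN) fun x hx => ?_
    obtain ⟨c, hc⟩ := exists_sub_mem_orthCompl hL x
    exact Submodule.mem_sup.2
      ⟨x - L c, ⟨sub_mem hx (hLN ⟨c, rfl⟩), hc⟩, L c, ⟨c, rfl⟩, sub_add_cancel _ _⟩
  · exact fun x hx y hy => hx.2 y hy
  · exact fun x hx hx0 => sqForm_pos_of_mem_orthCompl hκ hL hx.2 hx0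
  · exact exists_tendsto_sqForm (hN.inter (isClosed_orthCompl _))
      fun x hx hx0 => sqForm_pos_of_mem_orthCompl hκ hL hx.2 hx0
  · infer_instance
  · rintro _ ⟨c, rfl⟩ h0
    exact hL c fun hc => h0 (by rw [hc, map_zero])

include hκ hL in
/-- The orthogonal complement of a subspace that contains a maximal negative definite subspace is
a Hilbert subspace. -/
theorem isHilbertSubspace_orthCompl {N : Submodule ℂ X} (hLN : LinearMap.range L ≤ N) :
    IsHilbertSubspace (orthCompl N) := by
  have hpos : ∀ x ∈ orthCompl N, x ≠ 0 → 0 < sqForm x := fun x hx hx0 =>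
    sqForm_pos_of_mem_orthCompl hκ hL (orthCompl_anti hLN hx) hx0
  have hdec : IsFundamentalDecomposition (orthCompl N) (orthCompl N) ⊥ :=
    { sup_eq := sup_bot_eq _
      orth := fun x _ y hy => by rw [(Submodule.mem_bot ℂ).1 hy, form_zero_right]
      pos := hpos
      complete := exists_tendsto_sqForm (isClosed_orthCompl N) hpos
      finite := inferInstance
      neg := fun x hx hx0 => absurd ((Submodule.mem_bot ℂ).1 hx) hx0 }
  exact ⟨⟨isClosed_orthCompl N, _, _, hdec⟩, _, _, hdec, finrank_bot ℂ X⟩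

end NegativeSubspace

end Geometry

/-! ### From negative defects to regularity. -/

namespace LinearSystem

variable {X U Y : Type*}
  [NormedAddCommGroup X] [InnerProductSpace ℂ X] [CompleteSpace X] [PontryaginSpace X]
  [NormedAddCommGroup U] [InnerProductSpace ℂ U] [CompleteSpace U] [PontryaginSpace U]
  [NormedAddCommGroup Y] [InnerProductSpace ℂ Y] [CompleteSpace Y] [PontryaginSpace Y]

theorem dual_controllableSubspace (S : LinearSystem X U Y) :
    S.dual.controllableSubspace = S.observableSubspace := by
  simp only [controllableSubspace, observableSubspace, dual, indefAdjoint_pow]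

/-- A passive system whose truncated dual defect has negative dimension equal to the negative index
of the state space has regular structure subspaces with Hilbert orthogonal complements. -/
theorem IsPassive.isRegular_subspaces {S : LinearSystem X U Y} (hS : S.IsPassive)
    (hUY : negIndex U = negIndex Y) {n κ : ℕ} (hκ : negIndex X = κ)
    (h : NegDim (S.dualDefect n) κ) :
    (IsRegular S.controllableSubspace ∧ IsRegular S.observableSubspace ∧
      IsRegular S.simpleSubspace) ∧
    (IsHilbertSubspace (orthCompl S.controllableSubspace) ∧
      IsHilbertSubspace (orthCompl S.observableSubspace) ∧
      IsHilbertSubspace (orthCompl S.simpleSubspace)) := by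
  obtain ⟨φ, hφ⟩ := hS.negDim_state hUY h
  obtain ⟨ψ, hψ⟩ := hS.negDim_dual_state hUY h
  have hc : LinearMap.range (S.state n ∘ₗ φ) ≤ S.controllableSubspace := by
    rintro _ ⟨c, rfl⟩
    exact Submodule.le_topologicalClosure _ (S.state_mem n _)
  have ho : LinearMap.range (S.dual.state n ∘ₗ ψ) ≤ S.observableSubspace := by
    rw [← dual_controllableSubspace]
    rintro _ ⟨c, rfl⟩
    exact Submodule.le_topologicalClosure _ (S.dual.state_mem n _)
  have hs : LinearMap.range (S.state n ∘ₗ φ) ≤ S.simpleSubspace :=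
    hc.trans (Submodule.topologicalClosure_mono le_sup_left)
  exact ⟨⟨isRegular_of_range_le hκ hφ (Submodule.isClosed_topologicalClosure _) hc,
    isRegular_of_range_le hκ hψ (Submodule.isClosed_topologicalClosure _) ho,
    isRegular_of_range_le hκ hφ (Submodule.isClosed_topologicalClosure _) hs⟩,
    isHilbertSubspace_orthCompl hκ hφ hc, isHilbertSubspace_orthCompl hκ hψ ho,
    isHilbertSubspace_orthCompl hκ hφ hs⟩

end LinearSystem

/-! ### Sesquilinear forms given by Gram kernels, and the Hilbert space of a positive kernel. -/

section GramForm

variable {ι : Type*}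

/-- The sesquilinear form on finitely supported functions with Gram matrix `G`. -/
def gramForm (G : ι → ι → ℂ) (a b : ι →₀ ℂ) : ℂ :=
  a.sum fun p z => b.sum fun q w => conj z * w * G p q

variable (G : ι → ι → ℂ)

theorem gramForm_add_left (a b c : ι →₀ ℂ) :
    gramForm G (a + b) c = gramForm G a c + gramForm G b c := by
  rw [gramForm, Finsupp.sum_add_index'] <;> simp [gramForm, ← Finsupp.sum_add, add_mul]

theorem gramForm_add_right (a b c : ι →₀ ℂ) :
    gramForm G a (b + c) = gramForm G a b + gramForm G a c := by
  simp only [gramForm, ← Finsupp.sum_add]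
  refine Finsupp.sum_congr fun p _ => ?_
  rw [Finsupp.sum_add_index'] <;> simp [mul_add, add_mul]

theorem gramForm_smul_left (r : ℂ) (a b : ι →₀ ℂ) :
    gramForm G (r • a) b = conj r * gramForm G a b := by
  rw [gramForm, Finsupp.sum_smul_index] <;> simp [gramForm, Finsupp.mul_sum, mul_assoc]

theorem gramForm_smul_right (r : ℂ) (a b : ι →₀ ℂ) :
    gramForm G a (r • b) = r * gramForm G a b := by
  simp only [gramForm, Finsupp.mul_sum]
  refine Finsupp.sum_congr fun p _ => ?_
  rw [Finsupp.sum_smul_index (by simp)]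
  exact Finsupp.sum_congr fun q _ => by ring

theorem gramForm_zero_left (b : ι →₀ ℂ) : gramForm G 0 b = 0 := by simp [gramForm]

theorem gramForm_zero_right (a : ι →₀ ℂ) : gramForm G a 0 = 0 := by simp [gramForm]

theorem gramForm_single_single (p q : ι) :
    gramForm G (Finsupp.single p 1) (Finsupp.single q 1) = G p q := by simp [gramForm]

theorem gramForm_single_left (p : ι) (b : ι →₀ ℂ) :
    gramForm G (Finsupp.single p 1) b = b.sum fun q w => w * G p q := by simp [gramForm]

theorem gramForm_sum_left {T : Type*} (s : Finset T) (v : T → ι →₀ ℂ) (b : ι →₀ ℂ) :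
    gramForm G (∑ i ∈ s, v i) b = ∑ i ∈ s, gramForm G (v i) b :=
  map_sum (AddMonoidHom.mk' (fun a => gramForm G a b) fun x y => gramForm_add_left G x y b) v s

theorem gramForm_sum_right {T : Type*} (s : Finset T) (v : T → ι →₀ ℂ) (b : ι →₀ ℂ) :
    gramForm G b (∑ i ∈ s, v i) = ∑ i ∈ s, gramForm G b (v i) :=
  map_sum (AddMonoidHom.mk' (fun a => gramForm G b a) fun x y => gramForm_add_right G b x y) v s

variable {G}

theorem gramForm_conj (hG : ∀ p q, conj (G p q) = G q p) (a b : ι →₀ ℂ) :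
    conj (gramForm G a b) = gramForm G b a := by
  rw [gramForm, gramForm, Finsupp.sum_comm]
  simp only [map_finsuppSum]
  refine Finsupp.sum_congr fun p _ => Finsupp.sum_congr fun q _ => ?_
  simp only [map_mul, Complex.conj_conj, hG]
  ring

/-- Two sesquilinear forms on finitely supported functions agree if they agree on the basis. -/
theorem gramForm_eq_of_single {B : (ι →₀ ℂ) → (ι →₀ ℂ) → ℂ}
    (h1 : ∀ a b c, B (a + b) c = B a c + B b c) (h2 : ∀ a b c, B a (b + c) = B a b + B a c)
    (h3 : ∀ r a b, B (r • a) b = conj r * B a b) (h4 : ∀ r a b, B a (r • b) = r * B a b)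
    (h : ∀ p q, B (Finsupp.single p 1) (Finsupp.single q 1) = G p q) (a b : ι →₀ ℂ) :
    B a b = gramForm G a b := by
  have h5 : ∀ b, B 0 b = 0 := fun b => by simpa using h3 0 0 b
  have h6 : ∀ a, B a 0 = 0 := fun a => by simpa using h4 0 a 0
  induction a using Finsupp.induction_linear with
  | zero => rw [h5, gramForm_zero_left]
  | add x y hx hy => rw [h1, gramForm_add_left, hx, hy]
  | single p z =>
    induction b using Finsupp.induction_linear with
    | zero => rw [h6, gramForm_zero_right]
    | add x y hx hy => rw [h2, gramForm_add_right, hx, hy]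
    | single q w =>
      rw [← mul_one z, ← mul_one w, ← smul_eq_mul, ← smul_eq_mul, ← Finsupp.smul_single,
        ← Finsupp.smul_single, h3, h4, h, gramForm_smul_left, gramForm_smul_right,
        gramForm_single_single]

/-- A positive semidefinite kernel is the Gram kernel of a total family in a Hilbert space. -/
theorem exists_hilbert_gram {ι : Type u} {G : ι → ι → ℂ} (hG : ∀ p q, conj (G p q) = G q p)
    (hpos : ∀ a, 0 ≤ (gramForm G a a).re) :
    ∃ (H : Type u) (_ : NormedAddCommGroup H) (_ : InnerProductSpace ℂ H) (_ : CompleteSpace H)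
      (e : ι → H), (∀ p q, inner ℂ (e p) (e q) = G p q) ∧
        (Submodule.span ℂ (Set.range e)).topologicalClosure = ⊤ := by
  -- The scalar kernel is regarded as operator-valued on `ℂ`, so that reproducing kernel spaces
  -- apply; the kernel functions at `1` form the total family.
  let K : Matrix ι ι (ℂ →L[ℂ] ℂ) := Matrix.of fun x y => G x y • ContinuousLinearMap.id ℂ ℂ
  have hK : ∀ x y z, K x y z = G x y * z := fun x y z => by simp [K]
  have hpsd : K.PosSemidef := by
    have htfae := (RKHS.posSemidef_tfae (K := K)).out 0 2
    refine htfae.2 ⟨?_, fun v => ?_⟩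
    · ext x y
      refine ext_inner_right ℂ fun w => ?_
      rw [Matrix.conjTranspose_apply, ContinuousLinearMap.star_eq_adjoint,
        ContinuousLinearMap.adjoint_inner_left, hK, hK]
      simp [← hG x y, mul_comm]
    · refine (hpos v).trans_eq (congrArg Complex.re ?_)
      refine Finsupp.sum_congr fun p _ => Finsupp.sum_congr fun q _ => ?_
      rw [hK]
      simp only [RCLike.inner_apply, map_mul, hG]
      ring
  have : Fact K.PosSemidef := ⟨hpsd⟩
  refine ⟨RKHS.OfKernel K, inferInstance, inferInstance, inferInstance,
    fun p => RKHS.kerFun (RKHS.OfKernel K) p 1, fun p q => ?_, ?_⟩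
  · rw [← RKHS.kernel_inner, RKHS.OfKernel.kernel_ofKernel, hK]
    simp [hG]
  · rw [← RKHS.kerFun_dense (H := RKHS.OfKernel K)]
    congr 1
    refine le_antisymm (Submodule.span_mono ?_) (Submodule.span_le.2 ?_)
    · rintro _ ⟨p, rfl⟩
      exact ⟨p, 1, rfl⟩
    · rintro _ ⟨p, v, rfl⟩
      rw [← mul_one v, ← smul_eq_mul, map_smul]
      exact Submodule.smul_mem _ _ (Submodule.subset_span ⟨p, rfl⟩)

end GramForm

/-! ### Stability of negative definiteness. -/

section Perturbation

/-- Negative definiteness of a matrix is an open condition. -/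
theorem eventually_forall_re_sum_neg {T α : Type*} [Fintype T] {l : Filter α}
    {M : α → T → T → ℂ} {M₀ : T → T → ℂ}
    (hM : ∀ i j, Filter.Tendsto (fun n => M n i j) l (𝓝 (M₀ i j)))
    (h : ∀ c : T → ℂ, c ≠ 0 → (∑ i, ∑ j, conj (c i) * c j * M₀ i j).re < 0) :
    ∀ᶠ n in l, ∀ c : T → ℂ, c ≠ 0 → (∑ i, ∑ j, conj (c i) * c j * M n i j).re < 0 := by
  have hcont : Continuous fun p : (T → T → ℂ) × (T → ℂ) =>
      (∑ i, ∑ j, conj (p.2 i) * p.2 j * p.1 i j).re := by fun_prop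
  have h1 : ∀ᶠ N in 𝓝 M₀, ∀ c ∈ Metric.sphere (0 : T → ℂ) 1,
      (∑ i, ∑ j, conj (c i) * c j * N i j).re < 0 := by
    refine (isCompact_sphere _ _).eventually_forall_of_forall_eventually fun c hc => ?_
    exact hcont.continuousAt.eventually_lt continuousAt_const
      (h c (ne_zero_of_mem_unit_sphere ⟨c, hc⟩))
  have h2 : Filter.Tendsto M l (𝓝 M₀) :=
    tendsto_pi_nhds.2 fun i => tendsto_pi_nhds.2 fun j => hM i j
  filter_upwards [h2.eventually h1] with n hn c hc
  have hc' := norm_pos_iff.2 hc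
  have h3 := hn (((‖c‖⁻¹ : ℝ) : ℂ) • c) (by
    rw [mem_sphere_zero_iff_norm, norm_smul, Complex.norm_real, norm_inv, norm_norm,
      inv_mul_cancel₀ hc'.ne'])
  have h4 : ∑ i, ∑ j, conj ((((‖c‖⁻¹ : ℝ) : ℂ) • c) i) * (((‖c‖⁻¹ : ℝ) : ℂ) • c) j * M n i j =
      ((‖c‖⁻¹ ^ 2 : ℝ) : ℂ) * ∑ i, ∑ j, conj (c i) * c j * M n i j := by
    simp only [Finset.mul_sum, Pi.smul_apply, smul_eq_mul, map_mul, Complex.conj_ofReal]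
    refine Finset.sum_congr rfl fun i _ => Finset.sum_congr rfl fun j _ => ?_
    push_cast
    ring
  rw [h4, Complex.re_ofReal_mul] at h3
  by_contra hneg
  exact h3.not_ge (mul_nonneg (by positivity) (not_lt.1 hneg))

end Perturbation

/-! ### Turning a kernel with finitely many negative squares into a positive one. -/

section Indefinite

variable {ι : Type*} {G : ι → ι → ℂ} {T : Type*} [Fintype T]

theorem gramForm_sum_smul (v : T → ι →₀ ℂ) (c : T → ℂ) :
    gramForm G (∑ i, c i • v i) (∑ i, c i • v i) =
      ∑ i, ∑ j, conj (c i) * c j * gramForm G (v i) (v j) := by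
  simp only [gramForm_sum_left, gramForm_sum_right, gramForm_smul_left, gramForm_smul_right,
    mul_assoc, Finset.mul_sum]
  rw [Finset.sum_comm]
  exact Finset.sum_congr rfl fun i _ => Finset.sum_congr rfl fun j _ => mul_left_comm _ _ _

/-- The Gram kernel made positive by changing the sign on the span of `v`. -/
def flipKernel (G : ι → ι → ℂ) (v : T → ι →₀ ℂ) (p q : ι) : ℂ :=
  G p q + 2 * ∑ i, gramForm G (Finsupp.single p 1) (v i) * gramForm G (v i) (Finsupp.single q 1)

variable {v : T → ι →₀ ℂ}

theorem gramForm_flipKernel (a b : ι →₀ ℂ) : gramForm (flipKernel G v) a b =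
    gramForm G a b + 2 * ∑ i, gramForm G a (v i) * gramForm G (v i) b := by
  symm
  refine gramForm_eq_of_single
    (B := fun a b => gramForm G a b + 2 * ∑ i, gramForm G a (v i) * gramForm G (v i) b)
    ?_ ?_ ?_ ?_ (fun p q => ?_) a b
  · intro a b c
    simp only [gramForm_add_left, add_mul, Finset.sum_add_distrib]
    ring
  · intro a b c
    simp only [gramForm_add_right, mul_add, Finset.sum_add_distrib]
    ring
  · intro r a b
    simp only [gramForm_smul_left, mul_assoc, ← Finset.mul_sum]
    ring
  · intro r a b
    simp only [gramForm_smul_right, mul_left_comm _ r, ← Finset.mul_sum]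
    ring
  · rw [gramForm_single_single, flipKernel]

theorem flipKernel_conj (hG : ∀ p q, conj (G p q) = G q p) (p q : ι) : conj (flipKernel G v p q) = flipKernel G v q p := by
  simp only [flipKernel, map_add, map_mul, map_sum, gramForm_conj hG, hG, Complex.conj_ofNat]
  congr 2
  exact Finset.sum_congr rfl fun i _ => mul_comm _ _

variable {H : Type*} [NormedAddCommGroup H] [InnerProductSpace ℂ H] {e : ι → H}
  (he : ∀ p q, inner ℂ (e p) (e q) = flipKernel G v p q)

include he in
theorem inner_linearCombination (a b : ι →₀ ℂ) :
    inner ℂ (Finsupp.linearCombination ℂ e a) (Finsupp.linearCombination ℂ e b) =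
      gramForm (flipKernel G v) a b :=
  gramForm_eq_of_single
    (B := fun a b =>
      inner ℂ (Finsupp.linearCombination ℂ e a) (Finsupp.linearCombination ℂ e b))
    (by simp) (by simp) (by simp [mul_comm])
    (by simp) (by simp [he]) a b

variable [DecidableEq T] (hG : ∀ p q, conj (G p q) = G q p)
  (hv : ∀ i j, gramForm G (v i) (v j) = if i = j then -1 else 0)
  (hmax : ¬ NegDim (fun a => (gramForm G a a).re) (Fintype.card T + 1))

-- A negative vector orthogonal to all `v i` would enlarge their span to a negative definite family
-- of dimension one too many.
include hG hv hmax in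
theorem gramForm_nonneg_of_orth {a : ι →₀ ℂ} (ha : ∀ i, gramForm G (v i) a = 0) :
    0 ≤ (gramForm G a a).re := by
  by_contra hneg
  rw [not_le] at hneg
  refine hmax (negDim_of_finrank (V := (T → ℂ) × ℂ) (by simp)
    ((Fintype.linearCombination ℂ v).coprod (LinearMap.toSpanSingleton ℂ _ a)) ?_)
  rintro ⟨c, t⟩ hct
  have ha' : ∀ i, gramForm G a (v i) = 0 := fun i => by
    rw [← gramForm_conj hG, ha, map_zero]
  have h : gramForm G (∑ i, c i • v i + t • a) (∑ i, c i • v i + t • a) =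
      -((∑ i, ‖c i‖ ^ 2 : ℝ) : ℂ) + ((‖t‖ ^ 2 : ℝ) : ℂ) * gramForm G a a := by
    rw [gramForm_add_left, gramForm_add_right, gramForm_add_right, gramForm_sum_smul]
    simp only [gramForm_sum_left, gramForm_sum_right, gramForm_smul_left, gramForm_smul_right,
      ha, ha', hv, mul_ite, mul_zero, Finset.sum_ite_eq, Finset.mem_univ, if_true,
      Finset.sum_const_zero, mul_neg, mul_one, Finset.sum_neg_distrib, add_zero, zero_add]
    push_cast
    congr 1
    · congr 1
      exact Finset.sum_congr rfl fun i _ => by rw [Complex.conj_mul']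
    · rw [← mul_assoc, mul_comm t, Complex.conj_mul']
  simp only [LinearMap.coprod_apply, LinearMap.toSpanSingleton_apply,
    Fintype.linearCombination_apply]
  rw [h, Complex.add_re, Complex.neg_re, Complex.ofReal_re, Complex.re_ofReal_mul]
  have h1 : 0 ≤ ∑ i, ‖c i‖ ^ 2 := Finset.sum_nonneg fun i _ => by positivity
  by_cases ht : t = 0
  · have hc : c ≠ 0 := fun hc => hct (Prod.ext hc ht)
    obtain ⟨i, hi⟩ := Function.ne_iff.1 hc
    have h2 : 0 < ∑ i, ‖c i‖ ^ 2 := Finset.sum_pos' (fun i _ => by positivity)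
      ⟨i, Finset.mem_univ _, by have := norm_pos_iff.2 hi; positivity⟩
    simp [ht, h2]
  · have := norm_pos_iff.2 ht
    nlinarith [sq_pos_of_pos this]

include hG hv hmax in
theorem flipKernel_nonneg (a : ι →₀ ℂ) : 0 ≤ (gramForm (flipKernel G v) a a).re := by
  -- The projection is added, not subtracted, because the `v i` have square `-1`.
  let a' := a + ∑ i, gramForm G (v i) a • v i
  have h0 : ∀ i, gramForm G (v i) a' = 0 := by
    intro i
    simp only [a', gramForm_add_right, gramForm_sum_right, gramForm_smul_right, hv, mul_ite,
      mul_zero, mul_neg, mul_one, Finset.sum_ite_eq, Finset.mem_univ, if_true, add_neg_cancel]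
  have h1 := gramForm_nonneg_of_orth hG hv hmax h0
  have h2 : gramForm G a' a' = gramForm G a a' := by
    conv_lhs => rw [show a' = a + ∑ i, gramForm G (v i) a • v i from rfl, gramForm_add_left]
    simp only [gramForm_sum_left, gramForm_smul_left]
    rw [show a + ∑ i, gramForm G (v i) a • v i = a' from rfl]
    simp [h0]
  have h3 : gramForm G a a' = gramForm G a a + ((∑ i, ‖gramForm G (v i) a‖ ^ 2 : ℝ) : ℂ) := by
    simp only [a', gramForm_add_right, gramForm_sum_right, gramForm_smul_right]
    push_cast
    congr 1
    refine Finset.sum_congr rfl fun i _ => ?_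
    rw [← gramForm_conj hG (v i) a, Complex.mul_conj']
  have h4 : gramForm (flipKernel G v) a a =
      gramForm G a a + 2 * ((∑ i, ‖gramForm G (v i) a‖ ^ 2 : ℝ) : ℂ) := by
    rw [gramForm_flipKernel]
    push_cast
    congr 2
    refine Finset.sum_congr rfl fun i _ => ?_
    rw [← gramForm_conj hG (v i) a, Complex.conj_mul']
  rw [h2, h3, Complex.add_re, Complex.ofReal_re] at h1
  rw [h4, Complex.add_re, ← Complex.ofReal_ofNat, Complex.re_ofReal_mul, Complex.ofReal_re]
  have h5 : 0 ≤ ∑ i, ‖gramForm G (v i) a‖ ^ 2 := Finset.sum_nonneg fun i _ => by positivity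
  linarith

include hG hv he in
/-- Negative definiteness passes from `v` to finite combinations of a total subfamily. -/
theorem exists_neg_supported {D : Set ι}
    (hD : (Submodule.span ℂ (e '' D)).topologicalClosure = ⊤) :
    ∃ φ : (T → ℂ) →ₗ[ℂ] (ι →₀ ℂ), (∀ c, φ c ∈ Finsupp.supported ℂ ℂ D) ∧
      ∀ c, c ≠ 0 → (gramForm G (φ c) (φ c)).re < 0 := by
  let E := Finsupp.linearCombination ℂ e
  have hEv : ∀ i a, inner ℂ (E (v i)) (E a) = -gramForm G (v i) a := by
    intro i a
    rw [inner_linearCombination he, gramForm_flipKernel]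
    simp [hv]
    ring
  have hEv' : ∀ i a, inner ℂ (E a) (E (v i)) = -gramForm G a (v i) := by
    intro i a
    rw [← inner_conj_symm, hEv, map_neg, gramForm_conj hG]
  -- Undoing the flip writes the original form as the inner product minus a finite-rank term, so it
  -- is continuous in the Hilbert norm.
  have hB : ∀ a b, gramForm G a b = inner ℂ (E a) (E b) -
      2 * ∑ i, inner ℂ (E a) (E (v i)) * inner ℂ (E (v i)) (E b) := by
    intro a b
    simp only [hEv, hEv']
    rw [inner_linearCombination he, gramForm_flipKernel]
    simp
  have happrox : ∀ i, ∃ s : ℕ → ι →₀ ℂ, (∀ n, s n ∈ Finsupp.supported ℂ ℂ D) ∧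
      Filter.Tendsto (fun n => E (s n)) Filter.atTop (𝓝 (E (v i))) := by
    intro i
    have h1 : E (v i) ∈ closure (Submodule.span ℂ (e '' D) : Set H) := by
      rw [← Submodule.topologicalClosure_coe, hD]
      trivial
    obtain ⟨x, hx, hlim⟩ := mem_closure_iff_seq_limit.1 h1
    have h2 : ∀ n, ∃ a ∈ Finsupp.supported ℂ ℂ D, E a = x n := by
      intro n
      have := hx n
      rw [Finsupp.span_image_eq_map_linearCombination] at this
      exact this
    choose s hs hsx using h2
    exact ⟨s, hs, by simpa only [hsx] using hlim⟩
  choose s hs hlim using happrox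
  have hM : ∀ i j, Filter.Tendsto (fun n => gramForm G (s i n) (s j n)) Filter.atTop
      (𝓝 (gramForm G (v i) (v j))) := by
    intro i j
    simp only [hB]
    refine ((hlim i).inner (hlim j)).sub (Filter.Tendsto.const_mul _ ?_)
    refine tendsto_finsetSum _ fun k _ => ?_
    exact ((hlim i).inner tendsto_const_nhds).mul (tendsto_const_nhds.inner (hlim j))
  have hneg : ∀ c : T → ℂ, c ≠ 0 →
      (∑ i, ∑ j, conj (c i) * c j * gramForm G (v i) (v j)).re < 0 := by
    intro c hc
    obtain ⟨i, hi⟩ := Function.ne_iff.1 hc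
    have h1 : ∑ i, ∑ j, conj (c i) * c j * gramForm G (v i) (v j) =
        -((∑ i, ‖c i‖ ^ 2 : ℝ) : ℂ) := by
      simp [hv, Complex.conj_mul']
    rw [h1, Complex.neg_re, Complex.ofReal_re, neg_lt_zero]
    exact Finset.sum_pos' (fun i _ => by positivity)
      ⟨i, Finset.mem_univ _, by have := norm_pos_iff.2 hi; positivity⟩
  obtain ⟨n, hn⟩ := (eventually_forall_re_sum_neg hM hneg).exists
  refine ⟨Fintype.linearCombination ℂ fun i => s i n, fun c => ?_, fun c hc => ?_⟩
  · rw [Fintype.linearCombination_apply]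
    exact Submodule.sum_mem _ fun i _ => Submodule.smul_mem _ _ (hs i n)
  · rw [Fintype.linearCombination_apply, gramForm_sum_smul]
    exact hn c hc

end Indefinite

/-! ### Negative eigenvalues of a Hermitian matrix as inertia. -/

section Matrix

open Matrix

variable {n : ℕ} {M : Matrix (Fin n) (Fin n) ℂ} (hM : M.IsHermitian)

theorem nonnegCodim_negEigenvalueCount :
    NonnegCodim (fun x : Fin n → ℂ => (star x ⬝ᵥ M *ᵥ x).re) (negEigenvalueCount hM) := by
  let b := hM.eigenvectorBasis
  refine nonnegCodim_of_finrank (V := {i // hM.eigenvalues i < 0} → ℂ)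
    (by rw [Module.finrank_fintype_fun_eq_card, Fintype.card_subtype, negEigenvalueCount])
    (LinearMap.pi fun i => (innerₛₗ ℂ (b i)) ∘ₗ (WithLp.linearEquiv 2 ℂ (Fin n → ℂ)).symm.toLinearMap)
    fun x hx => ?_
  let X : EuclideanSpace ℂ (Fin n) := WithLp.toLp 2 x
  have hx' : ∀ i, hM.eigenvalues i < 0 → inner ℂ (b i) X = 0 := fun i hi => congrFun hx ⟨i, hi⟩
  have hsum : x = ∑ i, inner ℂ (b i) X • (b i).ofLp := by
    have h := congrArg WithLp.ofLp (b.sum_repr' X)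
    rw [WithLp.ofLp_sum] at h
    exact h.symm
  have hMx : M *ᵥ x = ∑ i, (inner ℂ (b i) X * hM.eigenvalues i) • (b i).ofLp := by
    conv_lhs => rw [hsum, Matrix.mulVec_sum]
    refine Finset.sum_congr rfl fun i _ => ?_
    rw [Matrix.mulVec_smul, hM.mulVec_eigenvectorBasis, mul_smul]
    rfl
  have hdot : ∀ i, star x ⬝ᵥ (b i).ofLp = conj (inner ℂ (b i) X) := by
    intro i
    rw [inner_conj_symm, EuclideanSpace.inner_eq_star_dotProduct, dotProduct_comm]
  rw [hMx, dotProduct_sum, Complex.re_sum]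
  refine Finset.sum_nonneg fun i _ => ?_
  rw [dotProduct_smul, hdot, smul_eq_mul, mul_right_comm, Complex.mul_conj', ← Complex.ofReal_pow,
    ← Complex.ofReal_mul, Complex.ofReal_re]
  by_cases hi : hM.eigenvalues i < 0
  · simp [hx' i hi]
  · exact mul_nonneg (by positivity) (not_lt.1 hi)

/-- Eigenvectors of the negative eigenvalues, rescaled by the inverse root of the absolute
eigenvalue. -/
theorem exists_neg_orthonormal : ∃ b : Fin (negEigenvalueCount hM) → (Fin n → ℂ),
    ∀ i j, star (b i) ⬝ᵥ M *ᵥ b j = if i = j then -1 else 0 := by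
  have hcard : Fintype.card {i // hM.eigenvalues i < 0} = negEigenvalueCount hM := by
    rw [Fintype.card_subtype, negEigenvalueCount]
  let σ := (Fintype.equivFinOfCardEq hcard).symm
  let l : Fin (negEigenvalueCount hM) → ℝ := fun i => hM.eigenvalues (σ i)
  have hl : ∀ i, l i < 0 := fun i => (σ i).2
  refine ⟨fun i => (((√(-l i))⁻¹ : ℝ) : ℂ) • (hM.eigenvectorBasis (σ i)).ofLp, fun i j => ?_⟩
  have hdot : star (hM.eigenvectorBasis (σ i)).ofLp ⬝ᵥ (hM.eigenvectorBasis (σ j)).ofLp =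
      if i = j then 1 else 0 := by
    rw [dotProduct_comm, ← EuclideanSpace.inner_eq_star_dotProduct,
      orthonormal_iff_ite.1 hM.eigenvectorBasis.orthonormal]
    simp [Subtype.coe_inj]
  have hmul : M *ᵥ (hM.eigenvectorBasis (σ j)).ofLp = (l j : ℂ) • (hM.eigenvectorBasis (σ j)).ofLp :=
    hM.mulVec_eigenvectorBasis _
  rw [Matrix.mulVec_smul, hmul, star_smul, smul_dotProduct, dotProduct_smul, dotProduct_smul, hdot]
  split_ifs with hij
  · subst hij
    have h1 : 0 < -l i := neg_pos.2 (hl i)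
    have h2 : (√(-l i))⁻¹ * ((√(-l i))⁻¹ * l i) = -1 := by
      rw [← mul_assoc, ← mul_inv, Real.mul_self_sqrt h1.le, inv_neg, neg_mul,
        inv_mul_cancel₀ (hl i).ne]
    simp only [smul_eq_mul, mul_one, Complex.star_def, Complex.conj_ofReal]
    exact_mod_cast h2
  · simp

/-- The quadratic form of a Gram matrix. -/
theorem gramForm_sum_single {ι : Type*} (G : ι → ι → ℂ) (p : Fin n → ι) (x y : Fin n → ℂ) :
    gramForm G (∑ i, x i • Finsupp.single (p i) 1) (∑ i, y i • Finsupp.single (p i) 1) =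
      star x ⬝ᵥ (Matrix.of fun i j => G (p i) (p j)) *ᵥ y := by
  simp only [gramForm_sum_left, gramForm_sum_right, gramForm_smul_left, gramForm_smul_right,
    gramForm_single_single, dotProduct, mulVec, Finset.mul_sum, Matrix.of_apply, Pi.star_apply,
    Complex.star_def]
  rw [Finset.sum_comm]
  exact Finset.sum_congr rfl fun i _ => Finset.sum_congr rfl fun j _ => by ring

end Matrix

/-! ### The Schur kernel as a scalar Gram kernel, and its inertia on `Ω`. -/

section SchurKernel

variable {U Y : Type*} [NormedAddCommGroup U] [InnerProductSpace ℂ U] [CompleteSpace U]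
  [PontryaginSpace U] [NormedAddCommGroup Y] [InnerProductSpace ℂ Y] [CompleteSpace Y]
  [PontryaginSpace Y] (θ : ℂ → U →L[ℂ] Y)

/-- The scalar Gram kernel of the Schur kernel. -/
def schurGram (p q : ℂ × Y) : ℂ := form (schurKernel θ q.1 p.1 q.2) p.2

theorem schurGram_eq (p q : ℂ × Y) : schurGram θ p q = (1 - p.1 * conj q.1)⁻¹ *
    (form q.2 p.2 - form (θ p.1 (indefAdjoint (θ q.1) q.2)) p.2) := by
  simp [schurGram, schurKernel, form_smul_left, form_sub_left]

theorem schurGram_conj (p q : ℂ × Y) : conj (schurGram θ p q) = schurGram θ q p :=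
  (schurMatrix_isHermitian θ ![p.1, q.1] ![p.2, q.2]).apply 1 0

variable {θ} {Ω : Set ℂ} (hball : Ω ⊆ Metric.ball 0 1)

include hball in
theorem one_sub_mul_conj_ne_zero {w z : ℂ} (hw : w ∈ Ω) (hz : z ∈ Ω) : 1 - z * conj w ≠ 0 := by
  have h1 : ‖w‖ < 1 := by simpa using hball hw
  have h2 : ‖z‖ < 1 := by simpa using hball hz
  intro h
  have h3 : ‖z * conj w‖ = 1 := by rw [← sub_eq_zero.1 h, norm_one]
  rw [norm_mul, RCLike.norm_conj] at h3
  nlinarith [norm_nonneg w, norm_nonneg z]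

include hball in
theorem differentiableOn_schurGram (hθ : DifferentiableOn ℂ θ Ω) (f : Y) {q : ℂ × Y}
    (hq : q.1 ∈ Ω) : DifferentiableOn ℂ (fun w => schurGram θ (w, f) q) Ω := by
  simp only [schurGram_eq]
  refine DifferentiableOn.mul (DifferentiableOn.inv (by fun_prop) fun z hz =>
    one_sub_mul_conj_ne_zero hball hq hz) ((differentiableOn_const _).sub ?_)
  exact ((innerSL ℂ f) ∘L (J : Y →L[ℂ] Y)).differentiable.comp_differentiableOn
    (hθ.clm_apply (differentiableOn_const _))

-- Continuity on the diagonal supplies the local norm bound for the kernel vectors.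
include hball in
theorem continuousOn_schurGram_self (hθ : ContinuousOn θ Ω) (f : Y) :
    ContinuousOn (fun w => schurGram θ (w, f) (w, f)) Ω := by
  simp only [schurGram_eq]
  have hc : Continuous (fun z : ℂ => 1 - z * conj z) :=
    continuous_const.sub (continuous_id.mul Complex.continuous_conj)
  refine ContinuousOn.mul (ContinuousOn.inv₀ hc.continuousOn
    fun z hz => one_sub_mul_conj_ne_zero hball hz hz) (continuousOn_const.sub ?_)
  refine continuous_form.comp_continuousOn (ContinuousOn.prodMk ?_ continuousOn_const)
  exact hθ.clm_apply ((continuous_indefAdjoint.comp_continuousOn hθ).clm_apply continuousOn_const)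

variable (θ Ω) in
/-- The Gram kernel of the Schur kernel on the domain `Ω`. -/
def schurGramOn (p q : Ω × Y) : ℂ := schurGram θ (p.1, p.2) (q.1, q.2)

/-- A finite-dimensional space of finitely supported functions lives on one finite set of points, so
the eigenvalue bound for a single Schur matrix applies. -/
theorem HasNegSquares.not_negDim {κ : ℕ} (h : HasNegSquares θ Ω κ) :
    ¬ NegDim (fun a : Ω × Y →₀ ℂ => (gramForm (schurGramOn θ Ω) a a).re) (κ + 1) := by
  classical
  rintro ⟨φ, hφ⟩
  let s : Finset (Ω × Y) := Finset.univ.biUnion fun i : Fin (κ + 1) => (φ (Pi.single i 1)).support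
  have hs : ∀ c, φ c ∈ Finsupp.supported ℂ ℂ (s : Set (Ω × Y)) := by
    intro c
    rw [← Finset.univ_sum_single c, map_sum]
    refine Submodule.sum_mem _ fun i _ => ?_
    rw [← mul_one (c i), ← smul_eq_mul, Pi.single_smul, map_smul]
    refine Submodule.smul_mem _ _ ?_
    rw [Finsupp.mem_supported]
    exact_mod_cast Finset.subset_biUnion_of_mem
      (fun i : Fin (κ + 1) => (φ (Pi.single i 1)).support) (Finset.mem_univ i)
  let σ := s.equivFin.symm
  let p : Fin s.card → Ω × Y := fun i => (σ i : Ω × Y)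
  have hexp : ∀ c, φ c = ∑ i, (φ c (p i)) • Finsupp.single (p i) 1 := by
    intro c
    have h1 : (φ c).sum Finsupp.single = φ c := Finsupp.sum_single _
    rw [Finsupp.sum_of_support_subset _ (Finsupp.mem_supported _ _ |>.1 (hs c)) _ (by simp)] at h1
    conv_lhs => rw [← h1, ← Finset.sum_coe_sort s, ← σ.sum_comp]
    exact Finset.sum_congr rfl fun i _ => by simp [p]
  let ψ : (Fin (κ + 1) → ℂ) →ₗ[ℂ] (Fin s.card → ℂ) :=
    LinearMap.pi fun i => Finsupp.lapply (p i) ∘ₗ φ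
  have hneg : NegDim (fun x : Fin s.card → ℂ =>
      (dotProduct (star x) (Matrix.mulVec (schurMatrix θ (fun i => ((p i).1 : ℂ))
        (fun i => (p i).2)) x)).re) (κ + 1) := by
    refine ⟨ψ, fun c hc => ?_⟩
    have h1 := hφ c hc
    simp only at h1
    rw [hexp c, gramForm_sum_single] at h1
    exact h1
  have h1 := hneg.le (nonnegCodim_negEigenvalueCount (schurMatrix_isHermitian θ _ _))
  have h2 := h.1 s.card (fun i => ((p i).1 : ℂ)) (fun i => (p i).2) fun i => (p i).1.2
  omega

theorem HasNegSquares.exists_neg_orthonormal {κ : ℕ} (h : HasNegSquares θ Ω κ) :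
    ∃ v : Fin κ → (Ω × Y →₀ ℂ),
      ∀ i j, gramForm (schurGramOn θ Ω) (v i) (v j) = if i = j then -1 else 0 := by
  obtain ⟨n, w, f, hw, rfl⟩ := h.2
  obtain ⟨b, hb⟩ := PontryaginSpace.exists_neg_orthonormal (schurMatrix_isHermitian θ w f)
  let p : Fin n → Ω × Y := fun i => (⟨w i, hw i⟩, f i)
  refine ⟨fun i => ∑ j, b i j • Finsupp.single (p j) 1, fun i j => ?_⟩
  rw [gramForm_sum_single, ← hb i j]
  rfl

end SchurKernel

/-! ### Holomorphy of a family tested against a total set. -/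

section Continuation

variable {H : Type*} [NormedAddCommGroup H] [InnerProductSpace ℂ H]

/-- A locally bounded family in a Hilbert space is weakly antiholomorphic if it is so when tested
against a total set. -/
theorem differentiableOn_inner_of_total {Ω : Set ℂ} (hΩ : IsOpen Ω) {e : ℂ → H}
    {A : Set H} (hA : (Submodule.span ℂ A).topologicalClosure = ⊤)
    (hd : ∀ a ∈ A, DifferentiableOn ℂ (fun w => inner ℂ (e w) a) Ω)
    {N : ℂ → ℝ} (hN : ContinuousOn N Ω) (heN : ∀ w ∈ Ω, ‖e w‖ ^ 2 ≤ N w) (h : H) :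
    DifferentiableOn ℂ (fun w => inner ℂ (e w) h) Ω := by
  have hspan : ∀ a ∈ Submodule.span ℂ A, DifferentiableOn ℂ (fun w => inner ℂ (e w) a) Ω := by
    intro a ha
    induction ha using Submodule.span_induction with
    | mem x hx => exact hd x hx
    | zero => simp
    | add x y _ _ hx hy =>
      simp only [inner_add_right]
      exact hx.add hy
    | smul c x _ hx =>
      simp only [inner_smul_right]
      exact hx.const_mul c
  have hmem : h ∈ closure (Submodule.span ℂ A : Set H) := by
    rw [← Submodule.topologicalClosure_coe, hA]
    trivial
  obtain ⟨x, hx, hlim⟩ := mem_closure_iff_seq_limit.1 hmem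
  refine TendstoLocallyUniformlyOn.differentiableOn (F := fun n w => inner ℂ (e w) (x n))
    (φ := Filter.atTop) ?_ (Filter.Eventually.of_forall fun n => hspan _ (hx n)) hΩ
  rw [Metric.tendstoLocallyUniformlyOn_iff]
  intro ε hε w hw
  -- The norms of `e z` are bounded near `w`, so approximating `h` by the span makes the inner
  -- products converge locally uniformly.
  have hNw : ∀ᶠ z in 𝓝[Ω] w, N z < N w + 1 :=
    (hN w hw).eventually_lt continuousWithinAt_const (lt_add_one _)
  refine ⟨_, Filter.inter_mem hNw self_mem_nhdsWithin, ?_⟩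
  have hN0 : 0 ≤ N w := (sq_nonneg _).trans (heN w hw)
  have h0 : Filter.Tendsto (fun n => √(N w + 1) * ‖h - x n‖) Filter.atTop (𝓝 0) := by
    simpa using ((hlim.const_sub h).norm.const_mul (√(N w + 1)))
  filter_upwards [h0.eventually_lt_const hε] with n hn z hz
  rw [dist_eq_norm, ← inner_sub_right]
  refine (norm_inner_le_norm _ _).trans_lt (lt_of_le_of_lt ?_ hn)
  refine mul_le_mul_of_nonneg_right (Real.le_sqrt_of_sq_le ?_) (norm_nonneg _)
  exact (heN z hz.2).trans (le_of_lt hz.1)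

end Continuation

/-! ### Moving the negative squares to a neighbourhood of the origin. -/

section Localization

variable {U : Type*} {Y : Type u} [NormedAddCommGroup U] [InnerProductSpace ℂ U] [CompleteSpace U]
  [PontryaginSpace U] [NormedAddCommGroup Y] [InnerProductSpace ℂ Y] [CompleteSpace Y]
  [PontryaginSpace Y] {θ : ℂ → U →L[ℂ] Y} {Ω : Set ℂ}

/-- For `h` orthogonal to the kernel vectors over `O`, the pairing with `h` is holomorphic in the
point and vanishes near `0`. Connectedness of `Ω` makes it vanish throughout, and totality gives `h
= 0`. -/
theorem span_image_dense {H : Type*} [NormedAddCommGroup H] [InnerProductSpace ℂ H]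
    [CompleteSpace H] (hΩ : IsOpen Ω)
    (hconn : IsPreconnected Ω) (h0 : (0 : ℂ) ∈ Ω) (hball : Ω ⊆ Metric.ball 0 1)
    (hθ : DifferentiableOn ℂ θ Ω) {κ : ℕ} {v : Fin κ → (Ω × Y →₀ ℂ)} {e : Ω × Y → H}
    (he : ∀ p q, inner ℂ (e p) (e q) = flipKernel (schurGramOn θ Ω) v p q)
    (htot : (Submodule.span ℂ (Set.range e)).topologicalClosure = ⊤)
    {O : Set ℂ} (hO : O ∈ 𝓝 (0 : ℂ)) :
    (Submodule.span ℂ (e '' {p | (p.1 : ℂ) ∈ O})).topologicalClosure = ⊤ := by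
  classical
  rw [Submodule.topologicalClosure_eq_top_iff, Submodule.eq_bot_iff]
  intro h hh
  have hconj : ∀ p q, conj (schurGramOn θ Ω p q) = schurGramOn θ Ω q p :=
    fun p q => schurGram_conj θ _ _
  have hzero : ∀ (f : Y) (w : Ω), inner ℂ (e (w, f)) h = 0 := by
    intro f
    let e' : ℂ → H := fun w => if hw : w ∈ Ω then e (⟨w, hw⟩, f) else 0
    have he' : ∀ {w} (hw : w ∈ Ω), e' w = e (⟨w, hw⟩, f) := fun hw => dif_pos hw
    let g : Fin κ → ℂ → ℂ := fun i w => (v i).sum fun q z => z * schurGram θ (w, f) (q.1, q.2)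
    have hg : ∀ i {w} (hw : w ∈ Ω),
        gramForm (schurGramOn θ Ω) (Finsupp.single (⟨w, hw⟩, f) 1) (v i) = g i w :=
      fun i w hw => gramForm_single_left _ _ _
    have hgd : ∀ i, DifferentiableOn ℂ (g i) Ω := fun i =>
      DifferentiableOn.fun_sum fun q _ =>
        (differentiableOn_schurGram hball hθ f q.1.2).const_mul _
    have hd : ∀ a ∈ Set.range e, DifferentiableOn ℂ (fun w => inner ℂ (e' w) a) Ω := by
      rintro _ ⟨q, rfl⟩
      have h1 : DifferentiableOn ℂ (fun w => schurGram θ (w, f) (q.1, q.2) + 2 * ∑ i,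
          g i w * gramForm (schurGramOn θ Ω) (v i) (Finsupp.single q 1)) Ω :=
        (differentiableOn_schurGram hball hθ f q.1.2).add
          (DifferentiableOn.const_mul (DifferentiableOn.fun_sum fun i _ =>
            (hgd i).mul_const _) _)
      refine h1.congr fun w hw => ?_
      simp only [he' hw, he, flipKernel, hg]
      rfl
    have hN : ContinuousOn (fun w => (schurGram θ (w, f) (w, f) + 2 * ∑ i,
        g i w * conj (g i w)).re) Ω := by
      refine Complex.continuous_re.comp_continuousOn
        ((continuousOn_schurGram_self hball hθ.continuousOn f).add
          (continuousOn_const.mul (continuousOn_finsetSum _ fun i _ => ?_)))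
      exact (hgd i).continuousOn.mul
        (Complex.continuous_conj.comp_continuousOn (hgd i).continuousOn)
    have heN : ∀ w ∈ Ω, ‖e' w‖ ^ 2 ≤ (schurGram θ (w, f) (w, f) + 2 * ∑ i,
        g i w * conj (g i w)).re := by
      intro w hw
      rw [← inner_self_eq_norm_sq (𝕜 := ℂ), he' hw, he, flipKernel]
      simp only [← gramForm_conj hconj (Finsupp.single _ _) (v _), hg]
      rfl
    have hdiff := differentiableOn_inner_of_total hΩ htot hd hN heN h
    have hev : (fun w => inner ℂ (e' w) h) =ᶠ[𝓝 0] 0 := by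
      filter_upwards [hO, hΩ.mem_nhds h0] with w hwO hw
      simp only [he' hw]
      exact hh _ (Submodule.subset_span ⟨_, hwO, rfl⟩)
    have hall := (hdiff.analyticOnNhd hΩ).eqOn_zero_of_preconnected_of_eventuallyEq_zero
      hconn h0 hev
    intro w
    have := hall w.2
    simp only [he' w.2] at this
    exact this
  have hall : ∀ x ∈ Submodule.span ℂ (Set.range e), inner ℂ x h = 0 := by
    intro x hx
    induction hx using Submodule.span_induction with
    | mem x hx =>
      obtain ⟨p, rfl⟩ := hx
      exact hzero p.2 p.1
    | zero => simp
    | add x y _ _ hx hy => rw [inner_add_left, hx, hy, add_zero]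
    | smul c x _ hx => rw [inner_smul_left, hx, mul_zero]
  have := (Submodule.topologicalClosure_eq_top_iff.1 htot)
  exact (Submodule.eq_bot_iff _).1 this h hall

theorem gramForm_mapDomain {ι ι' : Type*} (G : ι' → ι' → ℂ) (g : ι → ι') (a b : ι →₀ ℂ) :
    gramForm G (Finsupp.mapDomain g a) (Finsupp.mapDomain g b) =
      gramForm (fun p q => G (g p) (g q)) a b :=
  gramForm_eq_of_single
    (B := fun a b => gramForm G (Finsupp.mapDomain g a) (Finsupp.mapDomain g b))
    (by simp [Finsupp.mapDomain_add, gramForm_add_left])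
    (by simp [Finsupp.mapDomain_add, gramForm_add_right])
    (by simp [Finsupp.mapDomain_smul, gramForm_smul_left])
    (by simp [Finsupp.mapDomain_smul, gramForm_smul_right])
    (by simp [Finsupp.mapDomain_single, gramForm_single_single]) a b

/-- The negative squares of the Schur kernel are attained arbitrarily close to the origin. -/
theorem HasNegSquares.exists_neg_near {κ : ℕ} (hΩ : IsOpen Ω)
    (hconn : IsPreconnected Ω) (h0 : (0 : ℂ) ∈ Ω) (hball : Ω ⊆ Metric.ball 0 1)
    (hθ : DifferentiableOn ℂ θ Ω) (h : HasNegSquares θ Ω κ) {O : Set ℂ} (hO : O ∈ 𝓝 (0 : ℂ)) :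
    ∃ φ : (Fin κ → ℂ) →ₗ[ℂ] (ℂ × Y →₀ ℂ), (∀ c, ∀ p ∈ (φ c).support, p.1 ∈ O) ∧
      ∀ c, c ≠ 0 → (gramForm (schurGram θ) (φ c) (φ c)).re < 0 := by
  classical
  obtain ⟨v, hv⟩ := h.exists_neg_orthonormal
  have hconj : ∀ p q, conj (schurGramOn θ Ω p q) = schurGramOn θ Ω q p :=
    fun p q => schurGram_conj θ _ _
  have hmax : ¬ NegDim (fun a => (gramForm (schurGramOn θ Ω) a a).re) (Fintype.card (Fin κ) + 1) := by
    rw [Fintype.card_fin]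
    exact h.not_negDim
  obtain ⟨H, _, _, _, e, he, htot⟩ := exists_hilbert_gram (G := flipKernel (schurGramOn θ Ω) v)
    (flipKernel_conj hconj) (flipKernel_nonneg hconj hv hmax)
  obtain ⟨φ, hφ, hneg⟩ := exists_neg_supported he hconj hv
    (span_image_dense hΩ hconn h0 hball hθ he htot hO)
  let g : Ω × Y → ℂ × Y := fun p => (p.1, p.2)
  refine ⟨Finsupp.lmapDomain ℂ ℂ g ∘ₗ φ, fun c p hp => ?_, fun c hc => ?_⟩
  · obtain ⟨q, hq, rfl⟩ := Finset.mem_image.1 (Finsupp.mapDomain_support hp)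
    exact (Finsupp.mem_supported _ _).1 (hφ c) hq
  · have := hneg c hc
    rw [LinearMap.comp_apply, Finsupp.lmapDomain_apply, gramForm_mapDomain]
    exact this

end Localization

/-- The convolution of a geometric sequence with a convergent sequence. -/
theorem tendsto_sum_geometric_mul {r : ℂ} (hr : ‖r‖ < 1) {b : ℕ → ℂ} {β : ℂ}
    (hb : Filter.Tendsto b Filter.atTop (𝓝 β)) :
    Filter.Tendsto (fun n => ∑ k ∈ Finset.range n, r ^ k * b (n - 1 - k)) Filter.atTop
      (𝓝 ((1 - r)⁻¹ * β)) := by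
  obtain ⟨C, hC⟩ := (Metric.isBounded_range_of_tendsto b hb).exists_norm_le
  have hC' : ∀ n, ‖b n‖ ≤ C := fun n => hC _ ⟨n, rfl⟩
  have hC0 : 0 ≤ C := (norm_nonneg _).trans (hC' 0)
  have h := tendsto_tsum_of_dominated_convergence (𝓕 := Filter.atTop)
    -- The finite sums are written as series in `k`, dominated by a geometric one; for fixed `k` the
    -- index `n - 1 - k` tends to infinity.
    (f := fun n k => if k < n then r ^ k * b (n - 1 - k) else 0) (g := fun k => r ^ k * β)
    (bound := fun k => ‖r‖ ^ k * C)
    ((summable_geometric_of_lt_one (norm_nonneg r) hr).mul_right C) ?_ ?_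
  · rw [tsum_mul_right, tsum_geometric_of_norm_lt_one hr] at h
    refine h.congr fun n => ?_
    rw [tsum_eq_sum (s := Finset.range n) fun k hk => if_neg (by simpa using hk)]
    exact Finset.sum_congr rfl fun k hk => if_pos (Finset.mem_range.1 hk)
  · intro k
    have h1 : Filter.Tendsto (fun n => n - 1 - k) Filter.atTop Filter.atTop :=
      (Filter.tendsto_sub_atTop_nat k).comp (Filter.tendsto_sub_atTop_nat 1)
    refine ((hb.comp h1).const_mul (r ^ k)).congr' ?_
    filter_upwards [Filter.eventually_gt_atTop k] with n hn
    rw [if_pos hn]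
    rfl
  · refine Filter.Eventually.of_forall fun n k => ?_
    split_ifs
    · rw [norm_mul, norm_pow]
      exact mul_le_mul_of_nonneg_left (hC' _) (by positivity)
    · rw [norm_zero]
      positivity

/-! ### Geometric sequences: the truncated defect converges to the Schur kernel. -/

namespace LinearSystem

variable {X U : Type*} {Y : Type u}
  [NormedAddCommGroup X] [InnerProductSpace ℂ X] [CompleteSpace X] [PontryaginSpace X]
  [NormedAddCommGroup U] [InnerProductSpace ℂ U] [CompleteSpace U] [PontryaginSpace U]
  [NormedAddCommGroup Y] [InnerProductSpace ℂ Y] [CompleteSpace Y] [PontryaginSpace Y]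
  (S : LinearSystem X U Y)

/-- The partial sums of the power series of `C (I - z A)⁻¹`. -/
def observationSum (m : ℕ) (z : ℂ) : X →L[ℂ] Y :=
  S.C ∘L ∑ i ∈ Finset.range m, (z • S.A) ^ i

/-- The partial sums of the power series of the transfer function. -/
def transferSum (m : ℕ) (z : ℂ) : U →L[ℂ] Y := S.D + z • (S.observationSum m z ∘L S.B)

theorem observationSum_succ (m : ℕ) (z : ℂ) :
    S.observationSum (m + 1) z = S.C + z • (S.observationSum m z ∘L S.A) := by
  ext x
  simp only [observationSum, Finset.sum_range_succ', pow_zero, pow_succ]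
  simp [map_sum, add_comm, Finset.smul_sum]

theorem tendsto_transferSum {z : ℂ} (hz : ‖z • S.A‖ < 1) :
    Filter.Tendsto (fun m => S.transferSum m z) Filter.atTop (𝓝 (S.transferFunction z)) := by
  have h := (hasSum_geom_series_inverse (z • S.A) hz).tendsto_sum_nat
  have hc : Continuous fun R : X →L[ℂ] X => S.D + z • ((S.C ∘L R) ∘L S.B) := by fun_prop
  exact (hc.tendsto _).comp h

/-- The geometric sequence with ratio `conj p.1` and initial term `p.2`. -/
def geometricSeq {V : Type*} [AddCommGroup V] [Module ℂ V] (p : ℂ × V) (k : ℕ) : V :=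
  conj p.1 ^ k • p.2

/-- In reversed time the powers of `conj p.1` decrease, so the dual recursion is Horner's scheme for
the partial Neumann sum, with a leftover power of `n - m`. -/
theorem dual_state_geometricSeq (p : ℂ × Y) {n m : ℕ} (hm : m ≤ n) :
    S.dual.state m (reverse Y n (geometricSeq p)) =
      conj p.1 ^ (n - m) • indefAdjoint (S.observationSum m p.1) p.2 := by
  induction m with
  | zero => simp [state_zero, observationSum, indefAdjoint]
  | succ m ih =>
    have h1 : n - m = (n - (m + 1)) + 1 := by omega
    have h2 : n - 1 - m = n - (m + 1) := by omega
    rw [state_succ, ih (by omega), reverse_apply, h2, observationSum_succ, indefAdjoint_add,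
      indefAdjoint_smul, indefAdjoint_comp, h1, pow_succ]
    simp only [dual, geometricSeq, map_smul, _root_.add_apply, _root_.smul_apply,
      ContinuousLinearMap.comp_apply, smul_add, smul_smul]
    rw [add_comm]

theorem backOutput_geometricSeq (p : ℂ × Y) {n k : ℕ} (hk : k < n) :
    S.backOutput n (geometricSeq p) k =
      conj p.1 ^ k • indefAdjoint (S.transferSum (n - 1 - k) p.1) p.2 := by
  have h1 : n - (n - 1 - k) = k + 1 := by omega
  rw [backOutput_apply S hk, dual_state_geometricSeq S p (by omega), h1, transferSum,
    indefAdjoint_add, indefAdjoint_smul, indefAdjoint_comp, pow_succ]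
  simp only [geometricSeq, map_smul, _root_.add_apply, _root_.smul_apply,
    ContinuousLinearMap.comp_apply, smul_add, smul_smul]
  rw [add_comm]

/-- The Gram kernel of the truncated dual defect on geometric sequences. -/
def defectKernel (n : ℕ) (p q : ℂ × Y) : ℂ :=
  ∑ k ∈ Finset.range n, form (geometricSeq q k) (geometricSeq p k) -
    ∑ k ∈ Finset.range n, form (S.backOutput n (geometricSeq q) k)
      (S.backOutput n (geometricSeq p) k)

theorem dualDefect_linearCombination (n : ℕ) (a : ℂ × Y →₀ ℂ) :
    S.dualDefect n (Finsupp.linearCombination ℂ geometricSeq a) =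
      (gramForm (S.defectKernel n) a a).re := by
  let B : (ℂ × Y →₀ ℂ) → (ℂ × Y →₀ ℂ) → ℂ := fun a b =>
    ∑ k ∈ Finset.range n, form (Finsupp.linearCombination ℂ geometricSeq b k)
      (Finsupp.linearCombination ℂ geometricSeq a k) -
    ∑ k ∈ Finset.range n,
      form (S.backOutput n (Finsupp.linearCombination ℂ geometricSeq b) k)
        (S.backOutput n (Finsupp.linearCombination ℂ geometricSeq a) k)
  have h : B a a = gramForm (S.defectKernel n) a a := by
    refine gramForm_eq_of_single ?_ ?_ ?_ ?_ ?_ a a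
    · intro a b c
      simp only [B, map_add, Pi.add_apply, form_add_right, Finset.sum_add_distrib]
      ring
    · intro a b c
      simp only [B, map_add, Pi.add_apply, form_add_left, Finset.sum_add_distrib]
      ring
    · intro r a b
      simp only [B, map_smul, Pi.smul_apply, form_smul_right, ← Finset.mul_sum]
      ring
    · intro r a b
      simp only [B, map_smul, Pi.smul_apply, form_smul_left, ← Finset.mul_sum]
      ring
    · intro p q
      simp only [B, Finsupp.linearCombination_single, one_smul, defectKernel]
  rw [← h, dualDefect, Complex.sub_re, Complex.re_sum, Complex.re_sum]
  rfl

/-- The `k`-th summand is the `k`-th power of `p.1 * conj q.1` times a defect using the transfer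
series truncated at `n - 1 - k`. The sum is thus a convolution of a geometric and a convergent
sequence, and the factor `(1 - z * conj w)⁻¹` is the geometric series. -/
theorem tendsto_defectKernel {θ : ℂ → U →L[ℂ] Y} {p q : ℂ × Y} (hp1 : ‖p.1‖ < 1)
    (hq1 : ‖q.1‖ < 1) (hpA : ‖p.1 • S.A‖ < 1) (hqA : ‖q.1 • S.A‖ < 1)
    (hpθ : S.transferFunction p.1 = θ p.1) (hqθ : S.transferFunction q.1 = θ q.1) :
    Filter.Tendsto (fun n => S.defectKernel n p q) Filter.atTop (𝓝 (schurGram θ p q)) := by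
  have hr : ‖p.1 * conj q.1‖ < 1 := by
    rw [norm_mul, RCLike.norm_conj]
    nlinarith [norm_nonneg p.1, norm_nonneg q.1]
  have hlim : ∀ {s : ℂ × Y}, ‖s.1 • S.A‖ < 1 → S.transferFunction s.1 = θ s.1 →
      Filter.Tendsto (fun m => indefAdjoint (S.transferSum m s.1) s.2) Filter.atTop
        (𝓝 (indefAdjoint (θ s.1) s.2)) := by
    intro s hs hsθ
    rw [← hsθ]
    exact ((continuous_indefAdjoint.clm_apply continuous_const).tendsto _).comp
      (S.tendsto_transferSum hs)
  have hform := (continuous_form.tendsto _).comp ((hlim hqA hqθ).prodMk_nhds (hlim hpA hpθ))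
  have h := tendsto_sum_geometric_mul hr ((tendsto_const_nhds (x := form q.2 p.2)).sub hform)
  rw [schurGram_eq, form_indefAdjoint]
  refine h.congr fun n => ?_
  rw [defectKernel, ← Finset.sum_sub_distrib]
  refine Finset.sum_congr rfl fun k hk => ?_
  rw [backOutput_geometricSeq S _ (Finset.mem_range.1 hk),
    backOutput_geometricSeq S _ (Finset.mem_range.1 hk)]
  simp only [geometricSeq, form_smul_left, form_smul_right, map_pow, Complex.conj_conj,
    Function.comp_apply, mul_pow]
  ring

/-- The truncated dual defects of a realization of a generalized Schur function attain the number
of negative squares of the Schur kernel. -/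
theorem exists_negDim_dualDefect {κ : ℕ} {θ : ℂ → U →L[ℂ] Y}
    (hθ : θ ∈ generalizedSchurClass U Y κ) (hS : S.IsRealization θ) :
    ∃ n, NegDim (S.dualDefect n) κ := by
  obtain ⟨Ω, hΩ, hconn, h0, hball, hd, hneg⟩ := hθ
  have hA : ∀ᶠ z in 𝓝 (0 : ℂ), ‖z • S.A‖ < 1 := by
    have hc : Continuous fun z : ℂ => ‖z • S.A‖ := by fun_prop
    exact (hc.tendsto 0).eventually_lt_const (by simp)
  have h1 : ∀ᶠ z in 𝓝 (0 : ℂ), ‖z‖ < 1 :=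
    (continuous_norm.tendsto (0 : ℂ)).eventually_lt_const (by simp)
  obtain ⟨φ, hφ, hφneg⟩ := hneg.exists_neg_near hΩ hconn.isPreconnected h0 hball hd
    -- On this neighbourhood both the Neumann series and the geometric series converge, and the
    -- transfer function agrees with `θ`.
    (O := {z | ‖z‖ < 1 ∧ ‖z • S.A‖ < 1 ∧ S.transferFunction z = θ z})
    (by filter_upwards [hA, h1, hS] with z hz hz1 hz2 using ⟨hz1, hz, hz2.2⟩)
  let v : Fin κ → (ℂ × Y →₀ ℂ) := fun i => φ (Pi.single i 1)
  have hv : ∀ c, φ c = ∑ i, c i • v i := by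
    intro c
    conv_lhs => rw [← Finset.univ_sum_single c, map_sum]
    refine Finset.sum_congr rfl fun i _ => ?_
    rw [← map_smul, ← Pi.single_smul, smul_eq_mul, mul_one]
  have hlim : ∀ i j, Filter.Tendsto (fun n => gramForm (S.defectKernel n) (v i) (v j))
      Filter.atTop (𝓝 (gramForm (schurGram θ) (v i) (v j))) := by
    intro i j
    refine tendsto_finsetSum _ fun p hp => tendsto_finsetSum _ fun q hq => ?_
    obtain ⟨hp1, hp2, hp3⟩ := hφ _ p hp
    obtain ⟨hq1, hq2, hq3⟩ := hφ _ q hq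
    exact (S.tendsto_defectKernel hp1 hq1 hp2 hq2 hp3 hq3).const_mul _
  have hev := eventually_forall_re_sum_neg hlim fun c hc => by
    rw [← gramForm_sum_smul, ← hv]
    exact hφneg c hc
  obtain ⟨n, hn⟩ := hev.exists
  refine ⟨n, Finsupp.linearCombination ℂ geometricSeq ∘ₗ φ, fun c hc => ?_⟩
  rw [LinearMap.comp_apply, dualDefect_linearCombination, hv, gramForm_sum_smul]
  exact hn c hc

end LinearSystem

end PontryaginSpace

end

theorem mainTheorem8 {X U Y : Type*}
    [NormedAddCommGroup X] [InnerProductSpace ℂ X] [CompleteSpace X]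
    [TopologicalSpace.SeparableSpace X] [PontryaginSpace X]
    [NormedAddCommGroup U] [InnerProductSpace ℂ U] [CompleteSpace U]
    [TopologicalSpace.SeparableSpace U] [PontryaginSpace U]
    [NormedAddCommGroup Y] [InnerProductSpace ℂ Y] [CompleteSpace Y]
    [TopologicalSpace.SeparableSpace Y] [PontryaginSpace Y]
    (hUY : PontryaginSpace.negIndex U = PontryaginSpace.negIndex Y)
    (κ : ℕ) (hX : PontryaginSpace.negIndex X = κ)
    (θ : ℂ → U →L[ℂ] Y) (hθ : θ ∈ PontryaginSpace.generalizedSchurClass U Y κ)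
    (S : PontryaginSpace.LinearSystem X U Y) (hpassive : S.IsPassive)
    (hreal : S.IsRealization θ) :
    (PontryaginSpace.IsRegular S.controllableSubspace ∧
      PontryaginSpace.IsRegular S.observableSubspace ∧
      PontryaginSpace.IsRegular S.simpleSubspace) ∧
    (PontryaginSpace.IsHilbertSubspace (PontryaginSpace.orthCompl S.controllableSubspace) ∧
      PontryaginSpace.IsHilbertSubspace (PontryaginSpace.orthCompl S.observableSubspace) ∧
      PontryaginSpace.IsHilbertSubspace (PontryaginSpace.orthCompl S.simpleSubspace)) := by
  obtain ⟨n, hn⟩ := S.exists_negDim_dualDefect hθ hreal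
  exact hpassive.isRegular_subspaces hUY hX hn
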